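/- **Definitions.** Let $R$ be a unital associative algebra over $\mathbb R$ or $\mathbb C$ and $A\subseteq R$ a real linear subspace containing $1\neq 0$ and equipped with a partial order; products are computed in $R$, $A^+=\{a\in A:0\le a\}$, $C(B)$ is the set of elements of $A$ commuting with every element of $B\subseteq A$, and $CC(B)=C(C(B))$. $A$ is a *GH-algebra* if: * (SA1) $A$ is a partially ordered real vector space, archimedean (if $\{nv:n\ge 1\}$ is bounded above then $v\le 0$), with order unit $1$; * (SA2) $a^2\in A^+$ for $a\in A$; * (SA3) $aba\in A^+$ for $a,b\in A^+$; * (SA4) if $a\in A$, $b\in A^+$ and $aba=0$, then $ab=ba=0$; * (SA5) each $a\in A^+$ has some $b\in A^+\cap CC(\{a\})$ with $b^2=a$; * (SA6) for each $a\in A$ there is $p=p^2\in A$ such that, for all $b\in A$, $ab=0\Leftrightarrow pb=0$ (this $p$ is unique, called the carrier $a^{\circ}$ of $a$); * (SA7) if $1\le a\in A$, there is $b\in A$ with $ab=ba=1$; * (CV) every ascending sequence $(a_n)$ of pairwise commuting elements of $A$ that is bounded above in $A$ has a supremum in $A$, and this supremum lies in $CC(\{a_n:n\in\mathbb N\})$.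 $A$ is *commutative* if all its elements commute with one another. A *morphism of GH-algebras* $\phi:A_1\to A_2$ is a linear map with $\phi(1)=1$, $\phi(a^2)=\phi(a)^2$, $\phi(a)\phi(b)=\phi(b)\phi(a)$ whenever $ab=ba$, $\phi(a^{\circ})=\phi(a)^{\circ}$, and $\phi(a_n)\nearrow\phi(a)$ whenever $(a_n)$ is an ascending sequence of pairwise commuting elements with supremum $a$ in $A_1$; it is an *isomorphism* if it is bijective and its inverse is also a morphism. A *gh-tribe* on a nonempty set $X$ is a set $\mathcal T$ of bounded functions $X\to\mathbb R$ that contains the constants $0$ and $1$, is closed under addition and under multiplication by real numbers, and contains the pointwise supremum $\sup_n f_n$ of every sequence $(f_n)$ in $\mathcal T$ for which some $f\in\mathcal T$ satisfies $f_n\le f$ for all $n$. Gh-tribes and $C(X,\mathbb R)$ carry the pointwise order and operations. **Theorem (the GH-Loomis–Sikorski theorem).** Let $A$ be a commutative GH-algebra, let $P=\{p\in A:p^2=p\}$ be its Boolean algebra of projections, and let $X$ be the Stone space of $P$: a compact Hausdorff totally disconnected space with a Boolean isomorphism $e$ from $P$ onto the algebra of clopen subsets of $X$. Then $X$ is basically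 disconnected (the closure of every open $F_\sigma$ set is open), and there are a gh-tribe $\mathcal T$ on $X$ that is a GH-algebra with $C(X,\mathbb R)\subseteq\mathcal T$, and a surjective morphism of GH-algebras $h:\mathcal T\to A$. Moreover, $\mathcal T$ can be taken to be the set of all bounded real functions on $X$ that are measurable with respect to the Baire $\sigma$-algebra (the $\sigma$-algebra generated by $C(X,\mathbb R)$), and $h$ can be chosen so that, for some isomorphism of GH-algebras $\Psi:A\to C(X,\mathbb R)$ with $\Psi(p)=\chi_{e(p)}$ for all $p\in P$, one has for all $f\in\mathcal T$ and $a\in A$: $h(f)=a$ if and only if $\{x\in X: f(x)\neq\Psi(a)(x)\}$ is meager. -/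

import Mathlib

namespace GHAlg

/-- `(V, u)` is an order unit normed space: a partially ordered real vector space that is
archimedean and has `u` as a (strong) order unit. -/
structure IsOrderUnitNormedSpace (V : Type*) [AddCommGroup V] [Module ℝ V] [PartialOrder V]
    (u : V) : Prop where
  add_le_add : ∀ a b c : V, a ≤ b → a + c ≤ b + c
  smul_nonneg : ∀ (r : ℝ) (a : V), 0 ≤ r → 0 ≤ a → 0 ≤ r • a
  archimedean : ∀ v w : V, (∀ n : ℕ, 1 ≤ n → (n : ℝ) • v ≤ w) → 0 ≤ -v
  unit_nonneg : 0 ≤ u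
  le_unit : ∀ v : V, ∃ n : ℕ, 1 ≤ n ∧ v ≤ (n : ℝ) • u

section Synaptic

variable {R : Type*} [Ring R] [Algebra ℝ R]

/-- The commutant `C(B) = {b ∈ A : b commutes with every element of B}` of a subset `B` of `A`;
products are computed in the enveloping algebra `R`. -/
def commutant (A : Submodule ℝ R) (B : Set A) : Set A :=
  {b | ∀ a ∈ B, Commute (a : R) (b : R)}

/-- The double commutant `CC(B) = C(C(B))`. -/
def bicommutant (A : Submodule ℝ R) (B : Set A) : Set A :=
  commutant A (commutant A B)

/-- The set `P` of projections (idempotents) of `A`. -/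
def projections (A : Submodule ℝ R) : Set A :=
  {p | (p : R) * (p : R) = (p : R)}

/-- `p` is the carrier of `a`: a projection such that `a b = 0 ↔ p b = 0` for all `b ∈ A`. -/
def IsCarrier (A : Submodule ℝ R) (a p : A) : Prop :=
  p ∈ projections A ∧ ∀ b : A, (a : R) * (b : R) = 0 ↔ (p : R) * (b : R) = 0

/-- A generalized Hermitian algebra `A` with enveloping algebra `R`, that is, a real subspace `A`
of a unital associative algebra `R`, with a partial order on `A`, that satisfies the axioms
SA1--SA7 of a synaptic algebra and the commutative Vigier property (which replaces SA8).
The algebra is assumed to be nonzero. An enveloping algebra over `ℂ` is regarded as an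
algebra over `ℝ`; only its real structure enters. -/
structure IsGHAlgebra (A : Submodule ℝ R) [PartialOrder A] : Prop where
  one_ne_zero : (1 : R) ≠ 0
  one_mem : (1 : R) ∈ A
  sa1 : IsOrderUnitNormedSpace A ⟨1, one_mem⟩
  sa2 : ∀ a : A, ∃ c : A, (c : R) = (a : R) * (a : R) ∧ 0 ≤ c
  sa3 : ∀ a b : A, 0 ≤ a → 0 ≤ b → ∃ c : A, (c : R) = (a : R) * (b : R) * (a : R) ∧ 0 ≤ c
  sa4 : ∀ a b : A, 0 ≤ b → (a : R) * (b : R) * (a : R) = 0 →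
    (a : R) * (b : R) = 0 ∧ (b : R) * (a : R) = 0
  sa5 : ∀ a : A, 0 ≤ a → ∃ b : A, 0 ≤ b ∧ b ∈ bicommutant A {a} ∧ (b : R) * (b : R) = (a : R)
  sa6 : ∀ a : A, ∃ p : A, IsCarrier A a p
  sa7 : ∀ a : A, ⟨1, one_mem⟩ ≤ a → ∃ b : A, (a : R) * (b : R) = 1 ∧ (b : R) * (a : R) = 1
  cv : ∀ s : ℕ → A, Monotone s → BddAbove (Set.range s) →
    (∀ m n : ℕ, Commute (s m : R) (s n : R)) →
    ∃ a : A, a ∈ bicommutant A (Set.range s) ∧ IsLUB (Set.range s) a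

/-- `A` is commutative: any two elements of `A` commute, i.e. `A = C(A)`. -/
def IsCommutative (A : Submodule ℝ R) : Prop :=
  ∀ a b : A, Commute (a : R) (b : R)

end Synaptic

/-- A morphism of GH-algebras: a linear map that preserves the unit, squares, commutativity,
carriers, and suprema of ascending sequences of pairwise commuting elements. -/
structure IsGHMorphism {R₁ R₂ : Type*} [Ring R₁] [Algebra ℝ R₁] [Ring R₂] [Algebra ℝ R₂]
    (A₁ : Submodule ℝ R₁) [PartialOrder A₁] (A₂ : Submodule ℝ R₂) [PartialOrder A₂]
    (φ : A₁ →ₗ[ℝ] A₂) : Prop where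
  source : IsGHAlgebra A₁
  target : IsGHAlgebra A₂
  map_one : ∀ a : A₁, (a : R₁) = 1 → (φ a : R₂) = 1
  map_sq : ∀ a c : A₁, (c : R₁) = (a : R₁) * (a : R₁) → (φ c : R₂) = (φ a : R₂) * (φ a : R₂)
  map_commute : ∀ a b : A₁, Commute (a : R₁) (b : R₁) → Commute (φ a : R₂) (φ b : R₂)
  map_carrier : ∀ a p : A₁, IsCarrier A₁ a p → IsCarrier A₂ (φ a) (φ p)
  map_sup : ∀ (s : ℕ → A₁) (a : A₁), Monotone s →
    (∀ m n : ℕ, Commute (s m : R₁) (s n : R₁)) → IsLUB (Set.range s) a →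
    Monotone (fun n => φ (s n)) ∧ IsLUB (Set.range fun n => φ (s n)) (φ a)

/-- A bounded real-valued function. -/
def IsBoundedFun {X : Type*} (f : X → ℝ) : Prop :=
  ∃ α β : ℝ, ∀ x, α ≤ f x ∧ f x ≤ β

/-- A gh-tribe on the nonempty set `X`. -/
structure IsGHTribe {X : Type*} (T : Set (X → ℝ)) : Prop where
  nonempty : Nonempty X
  bounded : ∀ f ∈ T, IsBoundedFun f
  zero_mem : (fun _ => 0) ∈ T
  one_mem : (fun _ => 1) ∈ T
  add_mem : ∀ f ∈ T, ∀ g ∈ T, (fun x => f x + g x) ∈ T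
  smul_mem : ∀ (α : ℝ), ∀ f ∈ T, (fun x => α * f x) ∈ T
  sup_mem : ∀ (s : ℕ → X → ℝ), (∀ n, s n ∈ T) → ∀ f ∈ T, (∀ n x, s n x ≤ f x) →
    (fun x => ⨆ n, s n x) ∈ T

section Topology

variable (X : Type*) [TopologicalSpace X]

/-- `X` is basically disconnected: the closure of every open `F_σ` set is open. -/
def IsBasicallyDisconnected : Prop :=
  ∀ (U : Set X) (F : ℕ → Set X), IsOpen U → (∀ n, IsClosed (F n)) → U = ⋃ n, F n →
    IsOpen (closure U)

/-- `C(X, ℝ)` as a subspace of the algebra `ℝ^X`, with the pointwise order and operations. -/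
def continuousFunctions : Submodule ℝ (X → ℝ) where
  carrier := {f | Continuous f}
  add_mem' hf hg := hf.add hg
  zero_mem' := continuous_const
  smul_mem' r _ hf := hf.const_smul r

/-- The Baire σ-algebra of `X`: the smallest one for which all continuous real functions are
measurable. -/
abbrev baireMeasurableSpace : MeasurableSpace X :=
  ⨆ f : C(X, ℝ), MeasurableSpace.comap f (borel ℝ)

variable {X}

/-- A real function that is measurable for the Baire σ-algebra. -/
def IsBaireFun (f : X → ℝ) : Prop :=
  @Measurable X ℝ (baireMeasurableSpace X) (borel ℝ) f

end Topology

end GHAlg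

namespace GHAlg

/-! The heart is a Gelfand representation of `A` on `X`, built from order alone. A point `x` is an
ultrafilter of projections. Each real `l` splits the unit into a projection where `a ≤ l` and one
where `a ≥ l`; since `x` chooses one of the two, `a` acquires a Dedekind cut, its value at `x`
(`exists_value`). Values are multiplicative and continuous in `x`, and by the archimedean axiom they
determine the order (`gelfand_nonneg_iff`). The image separates points, so it is dense by
Stone–Weierstrass, and monotone sequential completeness upgrades density to surjectivity
(`gelfand_surjective`). Thus `A` is `C(X, ℝ)`.

Completeness of `C(X, ℝ)` makes `X` basically disconnected (`isBasicallyDisconnected_of_sup`), hence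
every Baire set is clopen modulo a meagre set (`exists_isClopen_residualEq`). Applied to binary
digits, this makes every bounded Baire function continuous modulo a meagre set, and the continuous
representative is unique by the Baire category theorem. Taking this representative and then
inverting the Gelfand isomorphism gives `h`. Suprema survive because those of Baire functions are
pointwise and only countably many meagre sets are discarded. -/

/-- The part of the axioms of a commutative GH-algebra that does not follow from the ordered
algebra structure. -/
structure IsSigmaCompleteAlgebra (S : Type*) [CommRing S] [Algebra ℝ S] [PartialOrder S] :
    Prop where
  archimedean : ∀ v w : S, (∀ n : ℕ, 1 ≤ n → (n : ℝ) • v ≤ w) → v ≤ 0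
  le_unit : ∀ v : S, ∃ n : ℕ, 1 ≤ n ∧ v ≤ (n : ℝ) • (1 : S)
  sq_nonneg : ∀ a : S, 0 ≤ a * a
  sqrt : ∀ a : S, 0 ≤ a → ∃ b, 0 ≤ b ∧ b * b = a
  carrier : ∀ a : S, ∃ p, p * p = p ∧ ∀ b, a * b = 0 ↔ p * b = 0
  sup : ∀ s : ℕ → S, Monotone s → BddAbove (Set.range s) → ∃ a, IsLUB (Set.range s) a

/-! ### Projections and splitting in a commutative ordered algebra. -/

section Spectral

variable {S : Type*} [CommRing S] [Algebra ℝ S] [PartialOrder S]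
  [IsOrderedRing S] [IsOrderedModule ℝ S]

omit [IsOrderedRing S] [IsOrderedModule ℝ S] in
theorem IsSigmaCompleteAlgebra.nonneg_of_idem (hS : IsSigmaCompleteAlgebra S) {p : S}
    (hp : p * p = p) : 0 ≤ p :=
  hp ▸ hS.sq_nonneg p

omit [IsOrderedModule ℝ S] in
theorem IsSigmaCompleteAlgebra.le_one_of_idem (hS : IsSigmaCompleteAlgebra S) {p : S}
    (hp : p * p = p) : p ≤ 1 := by
  have : (1 - p) * (1 - p) = 1 - p := by linear_combination hp
  exact sub_nonneg.1 (hS.nonneg_of_idem this)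

-- If `p ≤ q`, then `p * (1 - q)` is squeezed between `0` and `q * (1 - q) = 0`; conversely `q - p`
-- becomes idempotent, hence a square. This is what lets an order isomorphism of projections control
-- products.
omit [IsOrderedModule ℝ S] in
theorem IsSigmaCompleteAlgebra.idem_le_iff (hS : IsSigmaCompleteAlgebra S) {p q : S}
    (hp : p * p = p) (hq : q * q = q) : p ≤ q ↔ p * q = p := by
  constructor
  · intro h
    have h1 : 0 ≤ 1 - q := sub_nonneg.2 (hS.le_one_of_idem hq)
    have h2 : p * (1 - q) ≤ q * (1 - q) := mul_le_mul_of_nonneg_right h h1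
    have h3 : 0 ≤ p * (1 - q) := mul_nonneg (hS.nonneg_of_idem hp) h1
    have h4 : q * (1 - q) = 0 := by linear_combination -hq
    have h5 : p * (1 - q) = 0 := le_antisymm (h4 ▸ h2) h3
    linear_combination -h5
  · intro h
    have h1 : (q - p) * (q - p) = q - p := by linear_combination hp + hq - 2 * h
    exact sub_nonneg.1 (hS.nonneg_of_idem h1)

omit [IsOrderedModule ℝ S] in
/-- Each element is nonpositive under some projection and nonnegative under its complement. -/
theorem IsSigmaCompleteAlgebra.exists_split (hS : IsSigmaCompleteAlgebra S) (c : S) :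
    ∃ p : S, p * p = p ∧ c * p ≤ 0 ∧ 0 ≤ c * (1 - p) := by
  -- Here `d` plays the role of `|c|`, so `(d - c) * (d + c) = 0`; the carrier `p` of `d - c` kills
  -- `d + c`, and `1 - p` kills `d - c`.
  obtain ⟨d, hd0, hd⟩ := hS.sqrt (c * c) (hS.sq_nonneg c)
  obtain ⟨p, hp, hcar⟩ := hS.carrier (d - c)
  refine ⟨p, hp, ?_, ?_⟩
  · have h1 : p * (d + c) = 0 := (hcar _).1 (by linear_combination hd)
    have h2 : c * p = -(d * p) := by linear_combination h1
    rw [h2, neg_nonpos]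
    exact mul_nonneg hd0 (hS.nonneg_of_idem hp)
  · have h1 : (d - c) * (1 - p) = 0 := (hcar _).2 (by linear_combination -hp)
    have h2 : c * (1 - p) = d * (1 - p) := by linear_combination -h1
    rw [h2]
    exact mul_nonneg hd0 (sub_nonneg.2 (hS.le_one_of_idem hp))

theorem IsSigmaCompleteAlgebra.le_of_smul_le_smul (hS : IsSigmaCompleteAlgebra S) {p : S}
    (hp : p * p = p) (hp0 : p ≠ 0) {r s : ℝ} (h : r • p ≤ s • p) : r ≤ s := by
  by_contra! hlt
  have h0 := hS.nonneg_of_idem hp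
  have h1 : (r - s) • p ≤ 0 := by rw [sub_smul]; exact sub_nonpos.2 h
  have h2 : (r - s)⁻¹ • ((r - s) • p) ≤ (r - s)⁻¹ • (0 : S) :=
    smul_le_smul_of_nonneg_left h1 (inv_nonneg.2 (sub_pos.2 hlt).le)
  rw [smul_smul, inv_mul_cancel₀ (sub_pos.2 hlt).ne', one_smul, smul_zero] at h2
  exact hp0 (le_antisymm h2 h0)

theorem IsSigmaCompleteAlgebra.nonneg_of_forall (hS : IsSigmaCompleteAlgebra S) {a : S}
    (h : ∀ ε : ℝ, 0 < ε → -(ε • (1 : S)) ≤ a) : 0 ≤ a := by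
  rw [← neg_nonpos]
  refine hS.archimedean _ 1 fun n hn => ?_
  have hn' : (0 : ℝ) < n := by exact_mod_cast hn
  have h1 := neg_le.1 (h (n : ℝ)⁻¹ (inv_pos.2 hn'))
  have h2 := smul_le_smul_of_nonneg_left h1 hn'.le
  rwa [smul_smul, mul_inv_cancel₀ hn'.ne', one_smul] at h2

variable {X : Type*} [TopologicalSpace X] {P : Set S} (hP : ∀ p : S, p ∈ P ↔ p * p = p)
  (e : P ≃o TopologicalSpace.Clopens X)

/-! ### Boolean operations on projections read as operations on clopen sets. -/

section Iso
include hP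

-- The product of two idempotents is their meet, order isomorphisms preserve meets, and the meet of
-- clopen sets is the intersection.
omit [IsOrderedModule ℝ S] in
theorem mem_iso_mul (hS : IsSigmaCompleteAlgebra S) (p q : P) :
    ∃ r : P, (r : S) = p * q ∧ ∀ x, x ∈ e r ↔ x ∈ e p ∧ x ∈ e q := by
  have hp := (hP _).1 p.2
  have hq := (hP _).1 q.2
  have hr : ((p : S) * q) * (p * q) = p * q := by linear_combination q * q * hp + p * hq
  let r : P := ⟨p * q, (hP _).2 hr⟩
  have hglb : IsGLB {p, q} r := by
    constructor
    · rintro t (rfl | rfl)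
      · exact (hS.idem_le_iff hr hp).2 (by linear_combination q * hp)
      · exact (hS.idem_le_iff hr hq).2 (by linear_combination p * hq)
    · intro t ht
      have ht' := (hP _).1 t.2
      have h1 := (hS.idem_le_iff ht' hp).1 (ht (by simp) : t ≤ p)
      have h2 := (hS.idem_le_iff ht' hq).1 (ht (by simp) : t ≤ q)
      have h3 : (t : S) * (p * q) = t := by linear_combination q * h1 + h2
      exact (hS.idem_le_iff ht' hr).2 h3
  have h2 : IsGLB {e p, e q} (e r) := by
    have := e.isGLB_image'.2 hglb
    rwa [Set.image_pair] at this
  refine ⟨r, rfl, fun x => ?_⟩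
  rw [h2.unique isGLB_pair]
  rfl

omit [IsOrderedModule ℝ S] in
theorem mem_iso_of_eq_one (hS : IsSigmaCompleteAlgebra S) (p : P) (hp : (p : S) = 1) (x : X) :
    x ∈ e p := by
  have : IsTop p := fun q => show (q : S) ≤ p from hp ▸ hS.le_one_of_idem ((hP _).1 q.2)
  have h : (⊤ : TopologicalSpace.Clopens X) ≤ e p := by
    rw [← e.apply_symm_apply ⊤]; exact e.monotone (this _)
  exact h trivial

omit [IsOrderedRing S] [IsOrderedModule ℝ S] in
theorem notMem_iso_of_eq_zero (hS : IsSigmaCompleteAlgebra S) (p : P) (hp : (p : S) = 0) (x : X) :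
    x ∉ e p := by
  have : IsBot p := fun q => show (p : S) ≤ q from hp ▸ hS.nonneg_of_idem ((hP _).1 q.2)
  have h : e p ≤ (⊥ : TopologicalSpace.Clopens X) := by
    rw [← e.apply_symm_apply ⊥]; exact e.monotone (this _)
  exact fun hx => h hx

omit [IsOrderedRing S] [IsOrderedModule ℝ S] in
theorem exists_mem_iso (hS : IsSigmaCompleteAlgebra S) (p : P) (hp : (p : S) ≠ 0) :
    ∃ x, x ∈ e p := by
  by_contra! h
  have h1 : e p ≤ ⊥ := fun x hx => (h x hx).elim
  have h0 : (0 : S) ∈ P := (hP _).2 (mul_zero 0)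
  have h2 : e p ≤ e ⟨0, h0⟩ := h1.trans bot_le
  have h3 : (p : S) ≤ 0 := e.le_iff_le.1 h2
  exact hp (le_antisymm h3 (hS.nonneg_of_idem ((hP _).1 p.2)))

-- Disjointness comes from `p * (1 - p) = 0`. For covering, the projection `t` that corresponds to
-- the union absorbs both `p` and `1 - p`, so it is `1`.
omit [IsOrderedModule ℝ S] in
theorem mem_iso_compl (hS : IsSigmaCompleteAlgebra S) (p : P) :
    ∃ q : P, (q : S) = 1 - p ∧ ∀ x, x ∈ e q ↔ x ∉ e p := by
  have hp := (hP _).1 p.2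
  have hq : (1 - p : S) * (1 - p) = 1 - p := by linear_combination hp
  let q : P := ⟨1 - p, (hP _).2 hq⟩
  refine ⟨q, rfl, fun x => ⟨fun h1 h2 => ?_, fun h => ?_⟩⟩
  · obtain ⟨r, hr, hx⟩ := mem_iso_mul hP e hS p q
    refine notMem_iso_of_eq_zero hP e hS r ?_ x ((hx x).2 ⟨h2, h1⟩)
    rw [hr]; change (p : S) * (1 - p) = 0
    linear_combination -hp
  · have h1 : e p ≤ e.symm.symm (e.symm (e p ⊔ e q)) := by simp
    have h2 : e q ≤ e.symm.symm (e.symm (e p ⊔ e q)) := by simp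
    set t := e.symm (e p ⊔ e q) with ht
    have ht' := (hP _).1 t.2
    have h3 := (hS.idem_le_iff hp ht').1 (e.le_iff_le.1 h1 : p ≤ t)
    have h4 := (hS.idem_le_iff hq ht').1 (e.le_iff_le.1 h2 : q ≤ t)
    have h5 : (t : S) = 1 := by linear_combination h3 + h4
    have h6 := mem_iso_of_eq_one hP e hS t h5 x
    rw [ht, e.apply_symm_apply] at h6
    exact h6.resolve_left h

end Iso

/-! ### Characters at the points of the Stone space. -/

/-- The elements that are infinitesimal at the point `x`. -/
def IsInfinitesimalAt (x : X) (c : S) : Prop :=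
  ∀ ε : ℝ, 0 < ε → ∃ p : P, x ∈ e p ∧ -(ε • (p : S)) ≤ c * p ∧ c * p ≤ ε • (p : S)

include hP

omit [IsOrderedModule ℝ S] in
theorem IsInfinitesimalAt.add (hS : IsSigmaCompleteAlgebra S) {x : X} {c d : S}
    (hc : IsInfinitesimalAt e x c) (hd : IsInfinitesimalAt e x d) :
    IsInfinitesimalAt e x (c + d) := by
  intro ε hε
  obtain ⟨p, hxp, hp1, hp2⟩ := hc (ε / 2) (half_pos hε)
  obtain ⟨q, hxq, hq1, hq2⟩ := hd (ε / 2) (half_pos hε)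
  obtain ⟨r, hr, hxr⟩ := mem_iso_mul hP e hS p q
  have hq0 := hS.nonneg_of_idem ((hP _).1 q.2)
  have hp0 := hS.nonneg_of_idem ((hP _).1 p.2)
  have a1 := mul_le_mul_of_nonneg_right hp1 hq0
  have a2 := mul_le_mul_of_nonneg_right hp2 hq0
  have b1 := mul_le_mul_of_nonneg_right hq1 hp0
  have b2 := mul_le_mul_of_nonneg_right hq2 hp0
  have key : ε • ((p : S) * q) = (ε / 2) • (p : S) * q + (ε / 2) • (q : S) * p := by
    rw [smul_mul_assoc, smul_mul_assoc, mul_comm (q : S) p, ← add_smul, add_halves]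
  refine ⟨r, (hxr x).2 ⟨hxp, hxq⟩, ?_, ?_⟩
  · rw [hr, key]
    calc _ = -((ε / 2) • (p : S)) * q + -((ε / 2) • (q : S)) * p := by ring
      _ ≤ _ := add_le_add a1 b1
      _ = _ := by ring
  · rw [hr, key]
    calc _ = c * p * q + d * q * p := by ring
      _ ≤ _ := add_le_add a2 b2

omit hP in
theorem IsSigmaCompleteAlgebra.exists_bound (hS : IsSigmaCompleteAlgebra S) (b : S) :
    ∃ n : ℝ, 0 < n ∧ -(n • (1 : S)) ≤ b ∧ b ≤ n • (1 : S) := by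
  obtain ⟨m, hm1, hm⟩ := hS.le_unit b
  obtain ⟨n, hn1, hn⟩ := hS.le_unit (-b)
  have h01 : (0 : S) ≤ 1 := zero_le_one
  refine ⟨m + n, by positivity, ?_, ?_⟩
  · rw [neg_le]
    refine hn.trans (smul_le_smul_of_nonneg_right (by simp) h01)
  · exact hm.trans (smul_le_smul_of_nonneg_right (by simp) h01)

omit hP in
theorem IsInfinitesimalAt.mul_left (hS : IsSigmaCompleteAlgebra S) {x : X} {c : S} (b : S)
    (hc : IsInfinitesimalAt e x c) : IsInfinitesimalAt e x (b * c) := by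
  intro ε hε
  obtain ⟨n, hn, hb1, hb2⟩ := hS.exists_bound b
  obtain ⟨p, hxp, hp1, hp2⟩ := hc (ε / n) (div_pos hε hn)
  refine ⟨p, hxp, ?_⟩
  have key : ε • (p : S) = ((ε / n) • (p : S)) * (n • 1) := by
    rw [smul_mul_smul_comm, div_mul_cancel₀ _ hn.ne', mul_one]
  rw [key]
  generalize (ε / n) • (p : S) = u at *
  generalize n • (1 : S) = v at *
  -- Now `±(c * p) ≤ u` and `±b ≤ v`. Adding products of the nonnegative elements `u ± c * p` and `v
  -- ± b` with suitable signs gives twice `u * v ± b * c * p`.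
  have u1 : 0 ≤ u + c * p := by rw [add_comm, ← neg_le_iff_add_nonneg]; exact hp1
  have u2 : 0 ≤ u - c * p := sub_nonneg.2 hp2
  have v1 : 0 ≤ v + b := by rw [add_comm, ← neg_le_iff_add_nonneg]; exact hb1
  have v2 : 0 ≤ v - b := sub_nonneg.2 hb2
  have half : ∀ z : S, 0 ≤ z + z → 0 ≤ z := by
    intro z hz
    have := smul_nonneg (by norm_num : (0 : ℝ) ≤ 1 / 2) hz
    rwa [← two_smul ℝ z, smul_smul, show (1 / 2 : ℝ) * 2 = 1 by norm_num, one_smul] at this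
  constructor
  · rw [neg_le_iff_add_nonneg, add_comm]
    refine half _ ?_
    have := add_nonneg (mul_nonneg u1 v1) (mul_nonneg u2 v2)
    calc _ ≤ _ := this
      _ = _ := by ring
  · rw [← sub_nonneg]
    refine half _ ?_
    have := add_nonneg (mul_nonneg u1 v2) (mul_nonneg u2 v1)
    calc _ ≤ _ := this
      _ = _ := by ring

/-- Near `x` one has `a ≤ r + ε`. On the meet with `p` both bounds hold, and that meet is nonzero
because its clopen set contains `x`, so the scalars can be compared. -/
theorem le_of_infinitesimal (hS : IsSigmaCompleteAlgebra S) {x : X} {a : S} {r l : ℝ}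
    (ha : IsInfinitesimalAt e x (a - r • 1)) {p : P} (hxp : x ∈ e p) (h : l • (p : S) ≤ a * p) :
    l ≤ r := by
  refine le_of_forall_pos_le_add fun ε hε => ?_
  obtain ⟨q, hxq, -, hq⟩ := ha ε hε
  obtain ⟨t, ht, hxt⟩ := mem_iso_mul hP e hS p q
  have hq0 := hS.nonneg_of_idem ((hP _).1 q.2)
  have hp0 := hS.nonneg_of_idem ((hP _).1 p.2)
  have ht0 : (t : S) ≠ 0 := fun h0 =>
    notMem_iso_of_eq_zero hP e hS t h0 x ((hxt x).2 ⟨hxp, hxq⟩)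
  refine hS.le_of_smul_le_smul ((hP _).1 t.2) ht0 ?_
  rw [ht]
  have h1 : l • ((p : S) * q) ≤ a * (p * q) := by
    have := mul_le_mul_of_nonneg_right h hq0
    rwa [smul_mul_assoc, mul_assoc] at this
  have h2 : a * q ≤ (r + ε) • (q : S) := by
    rw [add_smul, add_comm]
    have : a * q - r • (q : S) ≤ ε • (q : S) := by
      simpa only [sub_mul, smul_mul_assoc, one_mul] using hq
    exact sub_le_iff_le_add.1 this
  have h3 := mul_le_mul_of_nonneg_right h2 hp0
  refine h1.trans ?_
  calc _ = a * q * p := by ring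
    _ ≤ _ := h3
    _ = _ := by rw [smul_mul_assoc, mul_comm (q : S)]

omit hP [IsOrderedModule ℝ S] in
theorem IsInfinitesimalAt.neg {x : X} {c : S} (hc : IsInfinitesimalAt e x c) :
    IsInfinitesimalAt e x (-c) := by
  intro ε hε
  obtain ⟨p, hxp, h1, h2⟩ := hc ε hε
  refine ⟨p, hxp, ?_, ?_⟩
  · rw [neg_mul]; exact neg_le_neg h2
  · rw [neg_mul]; exact neg_le.1 h1

theorem le_of_infinitesimal' (hS : IsSigmaCompleteAlgebra S) {x : X} {a : S} {r l : ℝ}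
    (ha : IsInfinitesimalAt e x (a - r • 1)) {p : P} (hxp : x ∈ e p) (h : a * p ≤ l • (p : S)) :
    r ≤ l := by
  have h1 : IsInfinitesimalAt e x (-a - (-r) • 1) := by
    convert ha.neg using 1
    rw [neg_smul]; abel
  have := le_of_infinitesimal hP e hS (l := -l) h1 hxp
    (by rw [neg_smul, neg_mul]; exact neg_le_neg h)
  linarith

/-- A Dedekind cut: `L` holds the scalars below `a` on some projection whose clopen set contains
`x`. Splitting `a - l` shows that each `l` outside `L` lies above `a` on such a projection, so `a`
is pinched around `sSup L`. -/
theorem exists_value (hS : IsSigmaCompleteAlgebra S) (x : X) (a : S) :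
    ∃ r : ℝ, IsInfinitesimalAt e x (a - r • 1) := by
  set L : Set ℝ := {l | ∃ p : P, x ∈ e p ∧ l • (p : S) ≤ a * p} with hL
  have h1P : (1 : S) ∈ P := (hP _).2 (mul_one 1)
  have hx1 : x ∈ e ⟨1, h1P⟩ := mem_iso_of_eq_one hP e hS _ rfl x
  obtain ⟨n, hn, hn1, hn2⟩ := hS.exists_bound a
  have hne : L.Nonempty := ⟨-n, ⟨1, h1P⟩, hx1, by simpa using hn1⟩
  have comb : ∀ l m : ℝ, ∀ p q : P, x ∈ e p → x ∈ e q → l • (p : S) ≤ a * p →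
      a * q ≤ m • (q : S) → l ≤ m := by
    intro l m p q hxp hxq h1 h2
    obtain ⟨t, ht, hxt⟩ := mem_iso_mul hP e hS p q
    have ht0 : (t : S) ≠ 0 := fun h0 =>
      notMem_iso_of_eq_zero hP e hS t h0 x ((hxt x).2 ⟨hxp, hxq⟩)
    refine hS.le_of_smul_le_smul ((hP _).1 t.2) ht0 ?_
    rw [ht]
    have a1 := mul_le_mul_of_nonneg_right h1 (hS.nonneg_of_idem ((hP _).1 q.2))
    have a2 := mul_le_mul_of_nonneg_right h2 (hS.nonneg_of_idem ((hP _).1 p.2))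
    rw [smul_mul_assoc] at a1 a2
    rw [mul_comm (q : S)] at a2
    exact a1.trans (le_trans (le_of_eq (by ring)) a2)
  have hbdd : BddAbove L := ⟨n, fun l ⟨p, hxp, h⟩ =>
    comb l n p ⟨1, h1P⟩ hxp hx1 h (by simpa using hn2)⟩
  have split : ∀ l : ℝ, l ∈ L ∨ ∃ p : P, x ∈ e p ∧ a * p ≤ l • (p : S) := by
    intro l
    obtain ⟨p, hp, h1, h2⟩ := hS.exists_split (a - l • 1)
    by_cases hx : x ∈ e ⟨p, (hP _).2 hp⟩
    · refine Or.inr ⟨_, hx, ?_⟩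
      simpa only [sub_mul, smul_mul_assoc, one_mul, sub_nonpos] using h1
    · obtain ⟨q, hq, hxq⟩ := mem_iso_compl hP e hS ⟨p, (hP _).2 hp⟩
      refine Or.inl ⟨q, (hxq x).2 hx, ?_⟩
      rw [hq]
      simpa only [sub_mul, smul_mul_assoc, one_mul, sub_nonneg] using h2
  refine ⟨sSup L, fun ε hε => ?_⟩
  obtain ⟨l, ⟨p, hxp, hp⟩, hl⟩ := exists_lt_of_lt_csSup hne (sub_lt_self (sSup L) hε)
  -- The number `sSup L + ε` is not in `L`, so the other alternative of the split supplies the upper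
  -- bound.
  obtain ⟨q, hxq, hq⟩ := (split (sSup L + ε)).resolve_left
    fun h => by linarith [le_csSup hbdd h]
  obtain ⟨t, ht, hxt⟩ := mem_iso_mul hP e hS p q
  have hp0 := hS.nonneg_of_idem ((hP _).1 p.2)
  have hq0 := hS.nonneg_of_idem ((hP _).1 q.2)
  have ht0 := hS.nonneg_of_idem ((hP _).1 t.2)
  have a1 := mul_le_mul_of_nonneg_right hp hq0
  have a2 := mul_le_mul_of_nonneg_right hq hp0
  rw [smul_mul_assoc, mul_assoc, ← ht] at a1
  rw [smul_mul_assoc, mul_assoc, mul_comm (q : S), ← ht] at a2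
  refine ⟨t, (hxt x).2 ⟨hxp, hxq⟩, ?_, ?_⟩
  · rw [sub_mul, smul_mul_assoc, one_mul, le_sub_iff_add_le, ← neg_smul, ← add_smul]
    exact (smul_le_smul_of_nonneg_right (by linarith) ht0).trans a1
  · rw [sub_mul, smul_mul_assoc, one_mul, sub_le_iff_le_add, ← add_smul, add_comm]
    exact a2

theorem isInfinitesimalAt_zero (hS : IsSigmaCompleteAlgebra S) (x : X) :
    IsInfinitesimalAt e x (0 : S) := by
  intro ε hε
  refine ⟨⟨1, (hP _).2 (mul_one 1)⟩, mem_iso_of_eq_one hP e hS _ rfl x, ?_⟩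
  have : 0 ≤ ε • (1 : S) := smul_nonneg hε.le zero_le_one
  simpa using this

theorem value_unique (hS : IsSigmaCompleteAlgebra S) {x : X} {a : S} {r s : ℝ}
    (hr : IsInfinitesimalAt e x (a - r • 1)) (hs : IsInfinitesimalAt e x (a - s • 1)) : r = s := by
  have key : ∀ r s : ℝ, IsInfinitesimalAt e x (a - r • 1) → IsInfinitesimalAt e x (a - s • 1) →
      r ≤ s := by
    intro r s hr hs
    refine le_of_forall_pos_le_add fun ε hε => ?_
    obtain ⟨p, hxp, hp, -⟩ := hr ε hε
    have h : (r - ε) • (p : S) ≤ a * p := by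
      rw [sub_mul, smul_mul_assoc, one_mul, le_sub_iff_add_le] at hp
      calc _ = _ := by rw [sub_smul]; abel
        _ ≤ _ := hp
    linarith [le_of_infinitesimal hP e hS hs hxp h]
  exact le_antisymm (key r s hr hs) (key s r hs hr)

/-- The character of `S` at the point `x`. -/
noncomputable def value (hS : IsSigmaCompleteAlgebra S) (x : X) (a : S) : ℝ :=
  (exists_value hP e hS x a).choose

theorem value_spec (hS : IsSigmaCompleteAlgebra S) (x : X) (a : S) :
    IsInfinitesimalAt e x (a - value hP e hS x a • 1) :=
  (exists_value hP e hS x a).choose_spec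

theorem value_eq (hS : IsSigmaCompleteAlgebra S) {x : X} {a : S} {r : ℝ}
    (h : IsInfinitesimalAt e x (a - r • 1)) : value hP e hS x a = r :=
  value_unique hP e hS (value_spec hP e hS x a) h

theorem value_smul_one (hS : IsSigmaCompleteAlgebra S) (x : X) (r : ℝ) :
    value hP e hS x (r • 1) = r :=
  value_eq hP e hS (by rw [sub_self]; exact isInfinitesimalAt_zero hP e hS x)

theorem value_add (hS : IsSigmaCompleteAlgebra S) (x : X) (a b : S) :
    value hP e hS x (a + b) = value hP e hS x a + value hP e hS x b := by
  refine value_eq hP e hS ?_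
  rw [add_smul, add_sub_add_comm]
  exact (value_spec hP e hS x a).add hP e hS (value_spec hP e hS x b)

theorem value_mul (hS : IsSigmaCompleteAlgebra S) (x : X) (a b : S) :
    value hP e hS x (a * b) = value hP e hS x a * value hP e hS x b := by
  refine value_eq hP e hS ?_
  -- With `r` and `s` the values of `a` and `b`, this uses `a * b - r * s = b * (a - r) + r * (b -
  -- s)`.
  have := ((value_spec hP e hS x a).mul_left e hS b).add hP e hS
    ((value_spec hP e hS x b).mul_left e hS (value hP e hS x a • 1))
  convert this using 1
  generalize value hP e hS x a = r
  generalize value hP e hS x b = s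
  simp only [Algebra.smul_def, mul_one, map_mul]
  ring

theorem le_value (hS : IsSigmaCompleteAlgebra S) {x : X} {a : S} {l : ℝ} {p : P}
    (hxp : x ∈ e p) (h : l • (p : S) ≤ a * p) : l ≤ value hP e hS x a :=
  le_of_infinitesimal hP e hS (value_spec hP e hS x a) hxp h

theorem value_le (hS : IsSigmaCompleteAlgebra S) {x : X} {a : S} {l : ℝ} {p : P}
    (hxp : x ∈ e p) (h : a * p ≤ l • (p : S)) : value hP e hS x a ≤ l :=
  le_of_infinitesimal' hP e hS (value_spec hP e hS x a) hxp h

theorem value_idem_of_mem (hS : IsSigmaCompleteAlgebra S) {x : X} {p : P} (h : x ∈ e p) :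
    value hP e hS x p = 1 := by
  have hp := (hP _).1 p.2
  exact le_antisymm (value_le hP e hS h (by rw [hp, one_smul]))
    (le_value hP e hS h (by rw [hp, one_smul]))

theorem value_idem_of_notMem (hS : IsSigmaCompleteAlgebra S) {x : X} {p : P} (h : x ∉ e p) :
    value hP e hS x p = 0 := by
  have hp := (hP _).1 p.2
  obtain ⟨q, hq, hxq⟩ := mem_iso_compl hP e hS p
  have h0 : (p : S) * q = (0 : ℝ) • (q : S) := by
    rw [hq, zero_smul]; linear_combination -hp
  exact le_antisymm (value_le hP e hS ((hxq x).2 h) h0.le)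
    (le_value hP e hS ((hxq x).2 h) h0.ge)

/-- A projection that pins `a` near its value at `x` gives the same bounds at every point of its
clopen set. -/
theorem continuous_value (hS : IsSigmaCompleteAlgebra S) (a : S) :
    Continuous fun x => value hP e hS x a := by
  rw [continuous_iff_continuousAt]
  intro x
  rw [ContinuousAt, Metric.tendsto_nhds]
  intro ε hε
  obtain ⟨p, hxp, h1, h2⟩ := value_spec hP e hS x a (ε / 2) (half_pos hε)
  filter_upwards [(e p).isClopen.isOpen.mem_nhds hxp] with y hy
  set r := value hP e hS x a
  rw [sub_mul, smul_mul_assoc, one_mul] at h1 h2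
  have h3 := le_value hP e hS (l := r - ε / 2) hy (a := a) (by
    rw [le_sub_iff_add_le] at h1
    calc _ = _ := by rw [sub_smul]; abel
      _ ≤ _ := h1)
  have h4 := value_le hP e hS (l := r + ε / 2) hy (a := a) (by
    rw [sub_le_iff_le_add] at h2
    calc _ ≤ _ := h2
      _ = _ := by rw [add_smul]; abel)
  rw [Real.dist_eq, abs_lt]
  constructor <;> linarith

/-! ### The Gelfand transform is an order isomorphism onto the continuous functions. -/

/-- The Gelfand transform of `S` on the Stone space of its projections. -/
noncomputable def gelfand (hS : IsSigmaCompleteAlgebra S) : S →ₐ[ℝ] C(X, ℝ) where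
  toFun a := ⟨fun x => value hP e hS x a, continuous_value hP e hS a⟩
  map_one' := by
    ext x; simpa using value_smul_one hP e hS x 1
  map_zero' := by
    ext x; simpa using value_smul_one hP e hS x 0
  map_mul' a b := by ext x; exact value_mul hP e hS x a b
  map_add' a b := by ext x; exact value_add hP e hS x a b
  commutes' r := by
    ext x; simpa [Algebra.algebraMap_eq_smul_one] using value_smul_one hP e hS x r

theorem gelfand_apply (hS : IsSigmaCompleteAlgebra S) (a : S) (x : X) :
    gelfand hP e hS a x = value hP e hS x a := rfl

/-- For the converse, split `a + ε`: a nonzero projection with `a ≤ -ε` on it would produce a point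
of negative value. So `a ≥ -ε` for all `ε`, and the archimedean axiom concludes. -/
theorem gelfand_nonneg_iff (hS : IsSigmaCompleteAlgebra S) (a : S) :
    0 ≤ gelfand hP e hS a ↔ 0 ≤ a := by
  constructor
  · intro h
    refine hS.nonneg_of_forall fun ε hε => ?_
    obtain ⟨p, hp, h1, h2⟩ := hS.exists_split (a - (-ε) • 1)
    have hp0 : p = 0 := by
      by_contra hp0
      obtain ⟨x, hx⟩ := exists_mem_iso hP e hS ⟨p, (hP _).2 hp⟩ hp0
      rw [sub_mul, smul_mul_assoc, one_mul, sub_nonpos] at h1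
      have h3 := value_le hP e hS hx h1
      have h4 : 0 ≤ value hP e hS x a := h x
      linarith
    rw [hp0, sub_zero, mul_one, sub_nonneg, neg_smul] at h2
    exact h2
  · intro h x
    refine le_value hP e hS (mem_iso_of_eq_one hP e hS ⟨1, (hP _).2 (mul_one 1)⟩ rfl x) ?_
    simpa using h

theorem gelfand_le_iff (hS : IsSigmaCompleteAlgebra S) (a b : S) :
    gelfand hP e hS a ≤ gelfand hP e hS b ↔ a ≤ b := by
  rw [← sub_nonneg, ← map_sub, gelfand_nonneg_iff, sub_nonneg]

theorem gelfand_injective (hS : IsSigmaCompleteAlgebra S) :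
    Function.Injective (gelfand hP e hS) := fun a b h =>
  le_antisymm ((gelfand_le_iff hP e hS a b).1 h.le) ((gelfand_le_iff hP e hS b a).1 h.ge)

/-- Stone–Weierstrass: projections transform to indicators of clopen sets, and these separate the
points of `X`. -/
theorem gelfand_dense (hS : IsSigmaCompleteAlgebra S)
    [CompactSpace X] [T2Space X] [TotallyDisconnectedSpace X] (f : C(X, ℝ)) {ε : ℝ} (hε : 0 < ε) :
    ∃ a : S, ∀ x, |gelfand hP e hS a x - f x| < ε := by
  have hsep : (gelfand hP e hS).range.SeparatesPoints := by
    intro x y hxy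
    obtain ⟨K, hK, hx, hy⟩ := exists_isClopen_of_totally_separated hxy
    refine ⟨_, ⟨gelfand hP e hS (e.symm ⟨K, hK⟩ : P), ⟨_, rfl⟩, rfl⟩, ?_⟩
    change value hP e hS x _ ≠ value hP e hS y _
    rw [value_idem_of_mem hP e hS, value_idem_of_notMem hP e hS]
    · exact one_ne_zero
    · rw [e.apply_symm_apply]; exact hy
    · rw [e.apply_symm_apply]; exact hx
  obtain ⟨⟨_, a, rfl⟩, ha⟩ :=
    ContinuousMap.exists_mem_subalgebra_near_continuousMap_of_separatesPoints _ hsep f ε hε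
  refine ⟨a, fun x => ?_⟩
  exact (ContinuousMap.norm_coe_le_norm (gelfand hP e hS a - f) x).trans_lt ha

/-- Suprema in `S` are not known to be pointwise, so the approximants must control the limit: the
supremum is trapped between `b n` and `b n + 4 * d n`, both of which tend uniformly to `f`. -/
theorem gelfand_surjective (hS : IsSigmaCompleteAlgebra S)
    [CompactSpace X] [T2Space X] [TotallyDisconnectedSpace X] :
    Function.Surjective (gelfand hP e hS) := by
  intro f
  set d : ℕ → ℝ := fun n => (1 / 2 : ℝ) ^ n with hd
  have hd0 : ∀ n, 0 < d n := fun n => by positivity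
  have hds : ∀ n, d (n + 1) = d n / 2 := fun n => by simp only [hd, pow_succ]; ring
  have hdl : Filter.Tendsto d Filter.atTop (nhds 0) :=
    tendsto_pow_atTop_nhds_zero_of_lt_one (by norm_num) (by norm_num)
  -- Approximating `f - 3 * d n` within `d n` puts `b n` between `f - 4 * d n` and `f - 2 * d n`. As
  -- `4 * d (n + 1) = 2 * d n`, these bands are stacked and the sequence increases.
  choose b hb using fun n : ℕ =>
    gelfand_dense hP e hS (f - ContinuousMap.const X (3 * d n)) (hd0 n)
  have hlo : ∀ n x, f x - 4 * d n ≤ gelfand hP e hS (b n) x := fun n x => by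
    have := (abs_lt.1 (hb n x)).1
    simp only [ContinuousMap.sub_apply, ContinuousMap.const_apply] at this
    linarith
  have hhi : ∀ n x, gelfand hP e hS (b n) x ≤ f x - 2 * d n := fun n x => by
    have := (abs_lt.1 (hb n x)).2
    simp only [ContinuousMap.sub_apply, ContinuousMap.const_apply] at this
    linarith
  have hmono : Monotone b := monotone_nat_of_le_succ fun n => by
    rw [← gelfand_le_iff hP e hS]
    intro x
    have h1 := hhi n x
    have h2 := hlo (n + 1) x
    rw [hds] at h2
    change gelfand hP e hS (b n) x ≤ gelfand hP e hS (b (n + 1)) x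
    linarith
  have hshift : ∀ n (x : X), gelfand hP e hS (b n + (4 * d n) • 1) x =
      gelfand hP e hS (b n) x + 4 * d n := fun n x => by
    rw [map_add, map_smul, map_one]; simp
  have hub : ∀ n, b n + (4 * d n) • 1 ∈ upperBounds (Set.range b) := by
    rintro n _ ⟨m, rfl⟩
    rw [← gelfand_le_iff hP e hS]
    intro x
    change gelfand hP e hS (b m) x ≤ gelfand hP e hS (b n + (4 * d n) • 1) x
    rw [hshift]
    linarith [hhi m x, hlo n x, hd0 m]
  obtain ⟨a, ha⟩ := hS.sup b hmono ⟨_, hub 0⟩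
  refine ⟨a, ?_⟩
  ext x
  have hl : Filter.Tendsto (fun n => 4 * d n) Filter.atTop (nhds 0) := by
    simpa using hdl.const_mul 4
  refine le_antisymm ?_ ?_
  · refine ge_of_tendsto' (x := Filter.atTop) (f := fun n => f x + 4 * d n)
      (by simpa using hl.const_add (f x)) fun n => ?_
    have h1 := (gelfand_le_iff hP e hS _ _).2 (ha.2 (hub n)) x
    have h2 := hshift n x
    have h3 := hhi n x
    have h4 := hd0 n
    have h5 : gelfand hP e hS a x ≤ gelfand hP e hS (b n + (4 * d n) • 1) x := h1
    linarith
  · refine le_of_tendsto' (x := Filter.atTop) (f := fun n => f x - 4 * d n)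
      (by simpa using hl.const_sub (f x)) fun n => ?_
    have h1 : gelfand hP e hS (b n) x ≤ gelfand hP e hS a x :=
      (gelfand_le_iff hP e hS _ _).2 (ha.1 ⟨n, rfl⟩) x
    exact (hlo n x).trans h1

end Spectral
open Filter Topology MeasureTheory

/-! ### Algebras of bounded functions and binary expansions. -/

section FunctionAlgebra

variable {X : Type*}

/-- A space of bounded functions with enough closure properties is a GH-algebra. -/
theorem isGHAlgebra_of_functions [Nonempty X] (T : Submodule ℝ (X → ℝ))
    (hb : ∀ f ∈ T, IsBoundedFun f) (h1 : (1 : X → ℝ) ∈ T)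
    (hmul : ∀ f ∈ T, ∀ g ∈ T, f * g ∈ T)
    (hsqrt : ∀ f ∈ T, (fun x => √(f x)) ∈ T)
    (hinv : ∀ f ∈ T, (∀ x, 1 ≤ f x) → f⁻¹ ∈ T)
    (hcar : ∀ a : T, ∃ p, IsCarrier T a p)
    (hsup : ∀ s : ℕ → T, Monotone s → BddAbove (Set.range s) →
      ∃ a, IsLUB (Set.range s) a) : IsGHAlgebra T where
  one_ne_zero := one_ne_zero
  one_mem := h1
  sa1 :=
    { add_le_add := fun a b c h x => by simpa using h x
      smul_nonneg := fun r a hr ha x => mul_nonneg hr (ha x)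
      archimedean := fun v w h x => by
        have hx : (v : X → ℝ) x ≤ 0 := by
          by_contra! hpos
          obtain ⟨n, hn⟩ := exists_nat_gt ((w : X → ℝ) x / (v : X → ℝ) x)
          rw [div_lt_iff₀ hpos] at hn
          have h2 : ((n + 1 : ℕ) : ℝ) * (v : X → ℝ) x ≤ (w : X → ℝ) x := h (n + 1) (by simp) x
          push_cast at h2
          nlinarith
        exact neg_nonneg.2 hx
      unit_nonneg := fun x => zero_le_one
      le_unit := fun v => by
        obtain ⟨α, β, hβ⟩ := hb v v.2
        obtain ⟨n, hn⟩ := exists_nat_ge β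
        refine ⟨n + 1, by simp, fun x => ?_⟩
        change (v : X → ℝ) x ≤ ((n + 1 : ℕ) : ℝ) * 1
        push_cast
        linarith [(hβ x).2] }
  sa2 a := ⟨⟨_, hmul a a.2 a a.2⟩, rfl, fun x => mul_self_nonneg _⟩
  sa3 a b ha hb := ⟨⟨_, hmul _ (hmul a a.2 b b.2) a a.2⟩, rfl,
    fun x => mul_nonneg (mul_nonneg (ha x) (hb x)) (ha x)⟩
  sa4 a b _ h := by
    have h0 : (a : X → ℝ) * b = 0 := by
      ext x
      have := congrFun h x
      simp only [Pi.mul_apply, Pi.zero_apply, mul_eq_zero] at this ⊢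
      tauto
    exact ⟨h0, (mul_comm _ _).trans h0⟩
  sa5 a ha := ⟨⟨_, hsqrt a a.2⟩, fun x => Real.sqrt_nonneg _, fun b _ => Commute.all _ _,
    funext fun x => Real.mul_self_sqrt (ha x)⟩
  sa6 := hcar
  sa7 a ha := by
    have h0 : ∀ x, (a : X → ℝ) x ≠ 0 := fun x => (zero_lt_one.trans_le (ha x)).ne'
    exact ⟨⟨_, hinv a a.2 ha⟩, funext fun x => mul_inv_cancel₀ (h0 x),
      funext fun x => inv_mul_cancel₀ (h0 x)⟩
  cv s hs hbdd _ := by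
    obtain ⟨a, ha⟩ := hsup s hs hbdd
    exact ⟨a, fun b _ => Commute.all _ _, ha⟩

/-- The remainder of `t ∈ [0, 1]` after removing its first binary digits. -/
noncomputable def binaryRemainder (f : X → ℝ) : ℕ → X → ℝ
  | 0 => f
  | n + 1 => fun x => 2 * binaryRemainder f n x -
      {y | 1 / 2 ≤ binaryRemainder f n y}.indicator (fun _ => 1) x

theorem binaryRemainder_mem {f : X → ℝ} (hf : ∀ x, f x ∈ Set.Icc (0 : ℝ) 1) (n : ℕ) (x : X) :
    binaryRemainder f n x ∈ Set.Icc (0 : ℝ) 1 := by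
  induction n with
  | zero => exact hf x
  | succ n ih =>
    obtain ⟨h0, h1⟩ := ih
    by_cases h : 1 / 2 ≤ binaryRemainder f n x
    · simp only [binaryRemainder, Set.indicator_of_mem
        (show x ∈ {y | 1 / 2 ≤ binaryRemainder f n y} from h)]
      constructor <;> linarith
    · simp only [binaryRemainder, Set.indicator_of_notMem
        (show x ∉ {y | 1 / 2 ≤ binaryRemainder f n y} from h)]
      constructor <;> linarith

/-- After `n` digits the error is `2⁻ⁿ` times a remainder in `[0, 1]`. The expansion reduces a
function to countably many sets, its digit sets. -/
theorem hasSum_binary {f : X → ℝ} (hf : ∀ x, f x ∈ Set.Icc (0 : ℝ) 1) (x : X) :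
    HasSum (fun n => (1 / 2 : ℝ) ^ (n + 1) *
      {y | 1 / 2 ≤ binaryRemainder f n y}.indicator (fun _ => 1) x) (f x) := by
  rw [hasSum_iff_tendsto_nat_of_nonneg
    fun n => mul_nonneg (by positivity) (Set.indicator_nonneg (fun _ _ => zero_le_one) x)]
  have hpart : ∀ n, ∑ i ∈ Finset.range n, (1 / 2 : ℝ) ^ (i + 1) *
      {y | 1 / 2 ≤ binaryRemainder f i y}.indicator (fun _ => 1) x =
      f x - (1 / 2) ^ n * binaryRemainder f n x := by
    intro n
    induction n with
    | zero => simp [binaryRemainder]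
    | succ n ih =>
      rw [Finset.sum_range_succ, ih, binaryRemainder]
      ring
  simp only [hpart]
  have h0 : Tendsto (fun n => (1 / 2 : ℝ) ^ n * binaryRemainder f n x) atTop (𝓝 0) := by
    refine squeeze_zero (fun n => mul_nonneg (by positivity) (binaryRemainder_mem hf n x).1)
      (fun n => mul_le_of_le_one_right (by positivity) (binaryRemainder_mem hf n x).2)
      (tendsto_pow_atTop_nhds_zero_of_lt_one (by norm_num) (by norm_num))
  simpa using h0.const_sub (f x)

theorem measurable_binaryRemainder {m : MeasurableSpace X} {f : X → ℝ} (hf : Measurable f)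
    (n : ℕ) : Measurable (binaryRemainder f n) := by
  induction n with
  | zero => exact hf
  | succ n ih =>
    exact (ih.const_mul 2).sub (measurable_const.indicator (measurableSet_le measurable_const ih))

theorem IsBoundedFun.mul {f g : X → ℝ} (hf : IsBoundedFun f) (hg : IsBoundedFun g) :
    IsBoundedFun (f * g) := by
  obtain ⟨α, β, hf⟩ := hf
  obtain ⟨γ, δ, hg⟩ := hg
  refine ⟨-((|α| + |β|) * (|γ| + |δ|)), (|α| + |β|) * (|γ| + |δ|), fun x => abs_le.1 ?_⟩
  rw [Pi.mul_apply, abs_mul]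
  refine mul_le_mul (abs_le.2 ⟨?_, ?_⟩) (abs_le.2 ⟨?_, ?_⟩) (abs_nonneg _) (by positivity)
  · linarith [neg_abs_le α, abs_nonneg β, (hf x).1]
  · linarith [abs_nonneg α, le_abs_self β, (hf x).2]
  · linarith [neg_abs_le γ, abs_nonneg δ, (hg x).1]
  · linarith [abs_nonneg γ, le_abs_self δ, (hg x).2]

end FunctionAlgebra

/-! ### Basic disconnectedness, Baire sets and functions modulo meagre sets. -/

section Topology

variable {X : Type*} [TopologicalSpace X]

theorem isMeagre_ne_iff {f g : X → ℝ} : IsMeagre {x | f x ≠ g x} ↔ f =ᶠ[residual X] g := by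
  rw [IsMeagre, Set.compl_ofPred]
  simp only [not_not]
  rfl

/-- In a Baire space a residual set is dense, while the set where the inequality holds is closed. -/
theorem le_of_residual_le [BaireSpace X] {f g : X → ℝ} (hf : Continuous f) (hg : Continuous g)
    (h : f ≤ᶠ[residual X] g) : f ≤ g := by
  have h1 : Dense {x | f x ≤ g x} := dense_of_mem_residual h
  have h2 : IsClosed {x | f x ≤ g x} := isClosed_le hf hg
  intro x
  have : x ∈ closure {x | f x ≤ g x} := h1 x
  rwa [h2.closure_eq] at this

theorem eq_of_residual_eq [BaireSpace X] {f g : X → ℝ} (hf : Continuous f) (hg : Continuous g)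
    (h : f =ᶠ[residual X] g) : f = g :=
  le_antisymm (le_of_residual_le hf hg h.le) (le_of_residual_le hg hf h.symm.le)

/-- Sequential completeness of `C(X, ℝ)` makes a Stone space basically disconnected. -/
theorem isBasicallyDisconnected_of_sup [CompactSpace X] [T2Space X] [TotallyDisconnectedSpace X]
    (hsup : ∀ s : ℕ → C(X, ℝ), Monotone s → BddAbove (Set.range s) →
      ∃ a, IsLUB (Set.range s) a) : IsBasicallyDisconnected X := by
  intro U F hU hF hUF
  -- Clopen sets interpolated between `F n` and `U` exhaust `U`; the indicators of their finite
  -- unions form an ascending sequence of continuous functions.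
  choose K hK hFK hKU using fun n => exists_clopen_of_closed_subset_open (hF n) hU
    (hUF ▸ Set.subset_iUnion F n)
  have hKc : ∀ n, IsClopen (Set.accumulate K n) := fun n =>
    (Set.finite_le_nat n).isClopen_biUnion fun i _ => hK i
  let s : ℕ → C(X, ℝ) := fun n =>
    ⟨(Set.accumulate K n).indicator fun _ => 1, (hKc n).continuous_indicator continuous_const⟩
  have hs : ∀ n x, s n x = (Set.accumulate K n).indicator (fun _ => (1 : ℝ)) x := fun _ _ => rfl
  have hmono : Monotone s := fun m n hmn x =>
    Set.indicator_le_indicator_of_subset (Set.monotone_accumulate hmn)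
      (fun _ => zero_le_one) x
  have h1 : (1 : C(X, ℝ)) ∈ upperBounds (Set.range s) := by
    rintro _ ⟨n, rfl⟩ x
    exact Set.indicator_le_self' (fun _ _ => zero_le_one) x
  obtain ⟨f, hf⟩ := hsup s hmono ⟨1, h1⟩
  have hsf : ∀ n x, s n x ≤ f x := fun n => hf.1 ⟨n, rfl⟩
  have hfU : U ⊆ {x | 1 ≤ f x} := by
    intro x hx
    rw [hUF] at hx
    obtain ⟨n, hn⟩ := Set.mem_iUnion.1 hx
    have h2 := hsf n x
    rwa [hs, Set.indicator_of_mem (Set.subset_accumulate (hFK n hn))] at h2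
  have hcl : closure U = {x | 0 < f x} := by
    refine Set.Subset.antisymm ?_ ?_
    · refine (closure_minimal hfU (isClosed_le continuous_const f.continuous)).trans ?_
      exact fun x (hx : 1 ≤ f x) => show 0 < f x from zero_lt_one.trans_le hx
    · intro x hx
      by_contra hxU
      -- Cutting the supremum `f` down to zero on a clopen neighbourhood of `x` that misses `closure
      -- U` leaves an upper bound, so leastness forces `f x ≤ 0`.
      obtain ⟨V, hV, hxV, hVU⟩ := compact_exists_isClopen_in_isOpen
        isClosed_closure.isOpen_compl hxU
      let g : C(X, ℝ) := ⟨Vᶜ.indicator f, hV.compl.continuous_indicator f.continuous⟩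
      have hg : g ∈ upperBounds (Set.range s) := by
        rintro _ ⟨n, rfl⟩ y
        change s n y ≤ Vᶜ.indicator f y
        by_cases hy : y ∈ V
        · rw [Set.indicator_of_notMem (by simpa using hy), hs, Set.indicator_of_notMem]
          intro hyn
          obtain ⟨i, -, hi⟩ := Set.mem_accumulate.1 hyn
          exact hVU hy (subset_closure (hKU i hi))
        · rw [Set.indicator_of_mem hy]
          exact hsf n y
      have h3 : f x ≤ Vᶜ.indicator f x := hf.2 hg x
      rw [Set.indicator_of_notMem (by simpa using hxV)] at h3
      exact absurd hx (not_lt.2 h3)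
  rw [hcl]
  exact isOpen_lt continuous_const f.continuous

/-- In a basically disconnected space every Baire set is clopen up to a meagre set. -/
theorem exists_isClopen_residualEq (hX : IsBasicallyDisconnected X) {B : Set X}
    (hB : MeasurableSet[baireMeasurableSpace X] B) :
    ∃ K, IsClopen K ∧ B =ᶠ[residual X] K := by
  have hopen : ∀ (U : Set X) (F : ℕ → Set X), IsOpen U → (∀ n, IsClosed (F n)) → U = ⋃ n, F n →
      ∃ K, IsClopen K ∧ U =ᶠ[residual X] K := fun U F hU hF hUF =>
    ⟨closure U, ⟨isClosed_closure, hX U F hU hF hUF⟩,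
      (closure_residualEq hU.isLocallyClosed).symm⟩
  -- The sets that are clopen modulo meagre form a σ-algebra: a countable union of clopen sets is an
  -- open `F_σ`, and it differs from its clopen closure by a nowhere dense set.
  let M : MeasurableSpace X :=
    { MeasurableSet' := fun B => ∃ K, IsClopen K ∧ B =ᶠ[residual X] K
      measurableSet_empty := ⟨∅, isClopen_empty, EventuallyEq.rfl⟩
      measurableSet_compl := fun B ⟨K, hK, hBK⟩ => ⟨Kᶜ, hK.compl, hBK.compl⟩
      measurableSet_iUnion := fun B hB => by
        choose K hK hBK using hB
        obtain ⟨L, hL, hKL⟩ := hopen (⋃ n, K n) K (isOpen_iUnion fun n => (hK n).isOpen)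
          (fun n => (hK n).isClosed) rfl
        exact ⟨L, hL, (Filter.EventuallyEq.countable_iUnion hBK).trans hKL⟩ }
  have hle : baireMeasurableSpace X ≤ M := by
    refine iSup_le fun f => ?_
    rw [← measurable_iff_comap_le, ← BorelSpace.measurable_eq (α := ℝ)]
    refine @measurable_of_Ioi ℝ X _ _ _ M _ _ _ _ fun c => ?_
    refine hopen _ (fun n : ℕ => f ⁻¹' Set.Ici (c + 1 / ((n : ℝ) + 1)))
      (isOpen_Ioi.preimage f.continuous) (fun n => isClosed_Ici.preimage f.continuous) ?_
    ext x
    simp only [Set.mem_preimage, Set.mem_Ioi, Set.mem_iUnion, Set.mem_Ici]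
    constructor
    · intro h
      obtain ⟨n, hn⟩ := exists_nat_one_div_lt (sub_pos.2 h)
      exact ⟨n, by linarith⟩
    · rintro ⟨n, hn⟩
      have : (0 : ℝ) < 1 / ((n : ℝ) + 1) := Nat.one_div_pos_of_nat
      linarith
  exact hle B hB

theorem isBaireFun_iff {f : X → ℝ} :
    IsBaireFun f ↔ Measurable[baireMeasurableSpace X] f := by
  rw [IsBaireFun, ← BorelSpace.measurable_eq (α := ℝ)]

/-- Replace every binary digit set by a clopen set equal to it modulo meagre. The new series
converges uniformly, so its sum is continuous, and only countably many meagre sets are lost. -/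
theorem exists_continuous_residualEq_of_mem_Icc (hX : IsBasicallyDisconnected X) {f : X → ℝ}
    (hf : IsBaireFun f) (h01 : ∀ x, f x ∈ Set.Icc (0 : ℝ) 1) :
    ∃ g : C(X, ℝ), f =ᶠ[residual X] g := by
  rw [isBaireFun_iff] at hf
  choose K hK hBK using fun n => exists_isClopen_residualEq hX
    (measurableSet_le (mδ := baireMeasurableSpace X) (measurable_const (a := (1 / 2 : ℝ)))
      (measurable_binaryRemainder hf n))
  have hcont : Continuous fun x => ∑' n : ℕ, (1 / 2 : ℝ) ^ (n + 1) *
      (K n).indicator (fun _ => 1) x := by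
    refine continuous_tsum
      (fun n => continuous_const.mul ((hK n).continuous_indicator continuous_const))
      (u := fun n => (1 / 2 : ℝ) ^ (n + 1)) ?_ ?_
    · simp only [pow_succ]
      exact (summable_geometric_of_lt_one (by norm_num) (by norm_num)).mul_right _
    · intro n x
      have h0 : (0 : ℝ) ≤ (K n).indicator (fun _ => 1) x :=
        Set.indicator_nonneg (fun _ _ => zero_le_one) x
      rw [Real.norm_of_nonneg (mul_nonneg (by positivity) h0)]
      exact mul_le_of_le_one_right (by positivity)
        (Set.indicator_le_self' (fun _ _ => zero_le_one) x)
  refine ⟨⟨_, hcont⟩, ?_⟩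
  filter_upwards [eventually_countable_forall.2 fun n => (hBK n).mem_iff] with x hx
  rw [← (hasSum_binary h01 x).tsum_eq]
  refine tsum_congr fun n => ?_
  congr 1
  by_cases h : x ∈ K n
  · have h' : x ∈ {y | 1 / 2 ≤ binaryRemainder f n y} := (hx n).2 h
    rw [Set.indicator_of_mem h', Set.indicator_of_mem h]
  · have h' : x ∉ {y | 1 / 2 ≤ binaryRemainder f n y} := fun h' => h ((hx n).1 h')
    rw [Set.indicator_of_notMem h', Set.indicator_of_notMem h]

/-- In a basically disconnected space every bounded Baire function is continuous up to a meagre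
set. -/
theorem exists_continuous_residualEq (hX : IsBasicallyDisconnected X) {f : X → ℝ}
    (hf : IsBaireFun f) (hb : IsBoundedFun f) : ∃ g : C(X, ℝ), f =ᶠ[residual X] g := by
  obtain ⟨α, β, hαβ⟩ := hb
  -- The added `1` keeps the divisor positive even when `α = β`.
  set c : ℝ := |β - α| + 1 with hc
  have hc0 : 0 < c := by positivity
  have hc1 : β - α ≤ c := (le_abs_self _).trans (by linarith)
  have h1 : IsBaireFun fun x => (f x - α) / c := by
    rw [isBaireFun_iff] at hf ⊢
    exact (hf.sub_const α).div_const c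
  obtain ⟨g, hg⟩ := exists_continuous_residualEq_of_mem_Icc hX h1 fun x =>
    ⟨div_nonneg (by linarith [(hαβ x).1]) hc0.le,
      (div_le_one hc0).2 (by linarith [(hαβ x).2])⟩
  refine ⟨ContinuousMap.const X α + c • g, ?_⟩
  filter_upwards [hg] with x hx
  simp only [ContinuousMap.add_apply, ContinuousMap.const_apply, ContinuousMap.smul_apply, ← hx,
    smul_eq_mul]
  rw [mul_div_cancel₀ _ hc0.ne']
  ring

variable (X) in
/-- The space of bounded Baire functions. -/
def baireFunctions : Submodule ℝ (X → ℝ) where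
  carrier := {f | IsBoundedFun f ∧ IsBaireFun f}
  add_mem' := by
    rintro f g ⟨⟨α, β, hf⟩, hf'⟩ ⟨⟨γ, δ, hg⟩, hg'⟩
    refine ⟨⟨α + γ, β + δ, fun x => ⟨add_le_add (hf x).1 (hg x).1,
      add_le_add (hf x).2 (hg x).2⟩⟩, ?_⟩
    rw [isBaireFun_iff] at *
    exact hf'.add hg'
  zero_mem' := ⟨⟨0, 0, fun _ => ⟨le_rfl, le_rfl⟩⟩, isBaireFun_iff.2 measurable_const⟩
  smul_mem' := by
    rintro r f ⟨⟨α, β, hf⟩, hf'⟩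
    refine ⟨⟨-(|r| * (|α| + |β|)), |r| * (|α| + |β|), fun x => abs_le.1 ?_⟩, ?_⟩
    · rw [Pi.smul_apply, smul_eq_mul, abs_mul]
      refine mul_le_mul_of_nonneg_left (abs_le.2 ⟨?_, ?_⟩) (abs_nonneg r)
      · linarith [neg_abs_le α, abs_nonneg β, (hf x).1]
      · linarith [abs_nonneg α, le_abs_self β, (hf x).2]
    · rw [isBaireFun_iff] at *
      exact hf'.const_smul r

theorem isBaireFun_of_continuous {f : X → ℝ} (hf : Continuous f) : IsBaireFun f :=
  measurable_iff_comap_le.2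
    (le_iSup (fun f : C(X, ℝ) => MeasurableSpace.comap f (borel ℝ)) ⟨f, hf⟩)

theorem isBoundedFun_of_continuous [CompactSpace X] {f : X → ℝ} (hf : Continuous f) :
    IsBoundedFun f := by
  obtain ⟨α, hα⟩ := (isCompact_range hf).bddBelow
  obtain ⟨β, hβ⟩ := (isCompact_range hf).bddAbove
  exact ⟨α, β, fun x => ⟨hα ⟨x, rfl⟩, hβ ⟨x, rfl⟩⟩⟩

theorem continuousFunctions_le_baireFunctions [CompactSpace X] :
    continuousFunctions X ≤ baireFunctions X := fun _ hf =>
  ⟨isBoundedFun_of_continuous hf, isBaireFun_of_continuous hf⟩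

theorem iSup_mem_baireFunctions {s : ℕ → X → ℝ} (hs : ∀ n, s n ∈ baireFunctions X)
    {f : X → ℝ} (hf : f ∈ baireFunctions X) (h : ∀ n x, s n x ≤ f x) :
    (fun x => ⨆ n, s n x) ∈ baireFunctions X := by
  obtain ⟨α, _, hα⟩ := (hs 0).1
  obtain ⟨_, β, hβ⟩ := hf.1
  refine ⟨⟨α, β, fun x => ⟨?_, ?_⟩⟩, isBaireFun_iff.2 (Measurable.iSup fun n =>
    isBaireFun_iff.1 (hs n).2)⟩
  · exact (hα x).1.trans (le_ciSup (f := fun n => s n x)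
      ⟨f x, by rintro _ ⟨n, rfl⟩; exact h n x⟩ 0)
  · exact ciSup_le fun n => (h n x).trans (hβ x).2

theorem isGHTribe_baireFunctions [Nonempty X] :
    IsGHTribe (baireFunctions X : Set (X → ℝ)) where
  nonempty := inferInstance
  bounded _ hf := hf.1
  zero_mem := (baireFunctions X).zero_mem
  one_mem := ⟨⟨1, 1, fun _ => ⟨le_rfl, le_rfl⟩⟩, isBaireFun_iff.2 measurable_const⟩
  add_mem _ hf _ hg := (baireFunctions X).add_mem hf hg
  smul_mem α _ hf := (baireFunctions X).smul_mem α hf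
  sup_mem _ hs _ hf h := iSup_mem_baireFunctions hs hf h

/-- The support of a bounded Baire function, as a projection. -/
theorem indicator_support_mem {f : X → ℝ} (hf : f ∈ baireFunctions X) :
    (Function.support f).indicator (fun _ => (1 : ℝ)) ∈ baireFunctions X :=
  ⟨⟨0, 1, fun x => ⟨Set.indicator_nonneg (fun _ _ => zero_le_one) x,
    Set.indicator_le_self' (fun _ _ => zero_le_one) x⟩⟩,
    isBaireFun_iff.2 (measurable_const.indicator
      (measurableSet_support (isBaireFun_iff.1 hf.2)))⟩

/-- Unlike in `C(X, ℝ)`, the pointwise supremum stays in the space; this makes suprema accessible to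
almost-everywhere arguments. -/
theorem isLUB_iSup_baireFunctions {s : ℕ → baireFunctions X} (hs : BddAbove (Set.range s)) :
    ∃ h, IsLUB (Set.range s) ⟨fun x => ⨆ n, (s n : X → ℝ) x, h⟩ := by
  obtain ⟨f, hf⟩ := hs
  have hle : ∀ n x, (s n : X → ℝ) x ≤ (f : X → ℝ) x := fun n => hf ⟨n, rfl⟩
  refine ⟨iSup_mem_baireFunctions (fun n => (s n).2) f.2 hle, ?_, ?_⟩
  · rintro _ ⟨n, rfl⟩ x
    exact le_ciSup (f := fun n => (s n : X → ℝ) x)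
      ⟨(f : X → ℝ) x, by rintro _ ⟨n, rfl⟩; exact hle n x⟩ n
  · intro g hg x
    exact ciSup_le fun n => hg ⟨n, rfl⟩ x

theorem isGHAlgebra_baireFunctions [Nonempty X] : IsGHAlgebra (baireFunctions X) := by
  refine isGHAlgebra_of_functions _ (fun f hf => hf.1) isGHTribe_baireFunctions.one_mem
    ?_ ?_ ?_ ?_ ?_
  · exact fun f hf g hg => ⟨hf.1.mul hg.1,
      isBaireFun_iff.2 ((isBaireFun_iff.1 hf.2).mul (isBaireFun_iff.1 hg.2))⟩
  · rintro f ⟨⟨α, β, hf⟩, hf'⟩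
    exact ⟨⟨0, √β, fun x => ⟨Real.sqrt_nonneg _, Real.sqrt_le_sqrt (hf x).2⟩⟩,
      isBaireFun_iff.2 (isBaireFun_iff.1 hf').sqrt⟩
  · intro f hf h1
    exact ⟨⟨0, 1, fun x => ⟨inv_nonneg.2 (zero_le_one.trans (h1 x)), inv_le_one_of_one_le₀ (h1 x)⟩⟩,
      isBaireFun_iff.2 (isBaireFun_iff.1 hf.2).inv⟩
  · intro f
    refine ⟨⟨_, indicator_support_mem f.2⟩, ?_, fun b => ?_⟩
    · ext x
      by_cases h : x ∈ Function.support (f : X → ℝ) <;> simp [h]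
    · simp only [funext_iff, Pi.mul_apply, Pi.zero_apply]
      refine forall_congr' fun x => ?_
      by_cases h : (f : X → ℝ) x = 0 <;> simp [h]
  · intro s _ hs
    obtain ⟨h, hh⟩ := isLUB_iSup_baireFunctions hs
    exact ⟨_, hh⟩

/-- A carrier of a Baire function vanishes at the same points as the function. -/
theorem eq_zero_iff_of_isCarrier {f p : baireFunctions X} (h : IsCarrier _ f p) (x : X) :
    (f : X → ℝ) x = 0 ↔ (p : X → ℝ) x = 0 := by
  obtain ⟨hp, hfp⟩ := h
  have one : (1 : X → ℝ) ∈ baireFunctions X :=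
    ⟨⟨1, 1, fun _ => ⟨le_rfl, le_rfl⟩⟩, isBaireFun_iff.2 measurable_const⟩
  constructor
  · intro hx
    -- The test element is the indicator of the zero set of `f`; in the other direction it is `1 -
    -- p`.
    let b : baireFunctions X := ⟨1, one⟩ - ⟨_, indicator_support_mem f.2⟩
    have hb : ∀ y, (b : X → ℝ) y =
      1 - (Function.support (f : X → ℝ)).indicator (fun _ => (1 : ℝ)) y := fun _ => rfl
    have h1 : (f : X → ℝ) * (b : X → ℝ) = 0 := by
      ext y
      rw [Pi.mul_apply, hb]
      by_cases h : (f : X → ℝ) y = 0 <;> simp [h]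
    have h2 := congrFun ((hfp b).1 h1) x
    rw [Pi.mul_apply, hb] at h2
    simpa [hx] using h2
  · intro hx
    let b : baireFunctions X := ⟨1, one⟩ - p
    have h1 : (p : X → ℝ) * (b : X → ℝ) = 0 := by
      ext y
      have := congrFun hp y
      change (p : X → ℝ) y * (1 - (p : X → ℝ) y) = 0
      simp only [Pi.mul_apply] at this
      linarith
    have h2 := congrFun ((hfp b).2 h1) x
    change (f : X → ℝ) x * (1 - (p : X → ℝ) x) = 0 at h2
    simpa [hx] using h2

end Topology

/-! ### From the axioms to an ordered ring and its representation. -/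

section Commutative

variable {R : Type*} [Ring R] [Algebra ℝ R] {A : Submodule ℝ R} [PartialOrder A]

/-- Polarization: the axioms provide squares, and `a * b` is half of `(a + b)² - a² - b²` when `a`
and `b` commute. -/
theorem IsGHAlgebra.mul_mem (hA : IsGHAlgebra A) (hc : IsCommutative A) (a b : A) :
    (a : R) * (b : R) ∈ A := by
  have hsq : ∀ c : A, (c : R) * (c : R) ∈ A := fun c => by
    obtain ⟨d, hd, -⟩ := hA.sa2 c
    exact hd ▸ d.2
  have h1 : (a : R) * b = (1 / 2 : ℝ) • (((a + b : A) : R) * ((a + b : A) : R) -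
      (a : R) * a - (b : R) * b) := by
    have h2 : ((a + b : A) : R) * ((a + b : A) : R) - (a : R) * a - (b : R) * b =
        (2 : ℝ) • ((a : R) * b) := by
      rw [two_smul, Submodule.coe_add, add_mul, mul_add, mul_add, (hc b a).eq]
      abel
    rw [h2, smul_smul]
    norm_num
  rw [h1]
  exact A.smul_mem _ (A.sub_mem (A.sub_mem (hsq _) (hsq a)) (hsq b))

/-- A commutative GH-algebra is a commutative ring. -/
abbrev IsGHAlgebra.commRing (hA : IsGHAlgebra A) (hc : IsCommutative A) : CommRing A :=
  { (inferInstance : AddCommGroup A) with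
    mul := fun a b => ⟨(a : R) * b, hA.mul_mem hc a b⟩
    one := ⟨1, hA.one_mem⟩
    mul_assoc := fun a b c => Subtype.ext (mul_assoc (a : R) b c)
    mul_comm := fun a b => Subtype.ext (hc a b)
    one_mul := fun a => Subtype.ext (one_mul (a : R))
    mul_one := fun a => Subtype.ext (mul_one (a : R))
    zero_mul := fun a => Subtype.ext (zero_mul (a : R))
    mul_zero := fun a => Subtype.ext (mul_zero (a : R))
    left_distrib := fun a b c => Subtype.ext (mul_add (a : R) b c)
    right_distrib := fun a b c => Subtype.ext (add_mul (a : R) b c) }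

/-- A commutative GH-algebra is an algebra over the reals. -/
abbrev IsGHAlgebra.algebra (hA : IsGHAlgebra A) (hc : IsCommutative A) :
    letI := hA.commRing hc
    Algebra ℝ A :=
  letI := hA.commRing hc
  Algebra.ofModule (fun r a b => Subtype.ext (smul_mul_assoc r (a : R) b))
    (fun r a b => Subtype.ext (mul_smul_comm r (a : R) b))

/-- Every commutative GH-algebra is represented by the continuous functions on the Stone space of
its projections. -/
theorem IsGHAlgebra.exists_representation (hA : IsGHAlgebra A) (hc : IsCommutative A)
    {X : Type*} [TopologicalSpace X] [CompactSpace X] [T2Space X] [TotallyDisconnectedSpace X]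
    (e : projections A ≃o TopologicalSpace.Clopens X) :
    ∃ Ψ : A ≃ₗ[ℝ] continuousFunctions X,
      (∀ a : A, (a : R) = 1 → (Ψ a : X → ℝ) = 1) ∧
      (∀ a b c : A, (c : R) = a * b ↔ (Ψ c : X → ℝ) = Ψ a * Ψ b) ∧
      (∀ a b : A, Ψ a ≤ Ψ b ↔ a ≤ b) ∧
      ∀ p : projections A,
        (Ψ (p : A) : X → ℝ) = Set.indicator (e p : Set X) (fun _ => 1) := by
  let _ := hA.commRing hc
  let _ := hA.algebra hc
  have coe_mul : ∀ a b : A, ((a * b : A) : R) = a * b := fun _ _ => rfl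
  have hadd : IsOrderedAddMonoid A :=
    { add_le_add_left := fun a b h c => by
        simpa [add_comm] using hA.sa1.add_le_add a b c h }
  have hmul : ∀ a b : A, 0 ≤ a → 0 ≤ b → 0 ≤ a * b := by
    intro a b ha hb
    -- With `c` a square root of `b`, commutativity gives `a * b = c * a * c`, which SA3 makes
    -- nonnegative.
    obtain ⟨c, hc0, -, hcb⟩ := hA.sa5 b hb
    obtain ⟨d, hd, hd0⟩ := hA.sa3 c a hc0 ha
    have : d = a * b := Subtype.ext (by rw [hd, coe_mul, ← hcb, (hc c a).eq, mul_assoc])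
    exact this ▸ hd0
  have hring : IsOrderedRing A :=
    { hadd with
      zero_le_one := hA.sa1.unit_nonneg
      mul_le_mul_of_nonneg_left := fun a ha b c h => by
        have := hmul a (c - b) ha (sub_nonneg.2 h)
        rwa [mul_sub, sub_nonneg] at this
      mul_le_mul_of_nonneg_right := fun a ha b c h => by
        have := hmul (c - b) a (sub_nonneg.2 h) ha
        rwa [sub_mul, sub_nonneg] at this }
  have hmod : IsOrderedModule ℝ A :=
    { smul_le_smul_of_nonneg_left := fun r hr a b h => by
        have := hA.sa1.smul_nonneg r (b - a) hr (sub_nonneg.2 h)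
        rwa [smul_sub, sub_nonneg] at this
      smul_le_smul_of_nonneg_right := fun a ha r s h => by
        have := hA.sa1.smul_nonneg (s - r) a (sub_nonneg.2 h) ha
        rwa [sub_smul, sub_nonneg] at this }
  have coe_eq_zero : ∀ a b : A, (a : R) * b = 0 ↔ a * b = 0 := fun a b =>
    ⟨fun h => Subtype.ext h, fun h => congrArg Subtype.val h⟩
  have hS : IsSigmaCompleteAlgebra A :=
    { archimedean := fun v w h => neg_nonneg.1 (hA.sa1.archimedean v w h)
      le_unit := hA.sa1.le_unit
      sq_nonneg := fun a => by
        obtain ⟨c, hca, hc0⟩ := hA.sa2 a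
        have : c = a * a := Subtype.ext hca
        exact this ▸ hc0
      sqrt := fun a ha => by
        obtain ⟨b, hb, -, hba⟩ := hA.sa5 a ha
        exact ⟨b, hb, Subtype.ext hba⟩
      carrier := fun a => by
        obtain ⟨p, hp, hap⟩ := hA.sa6 a
        exact ⟨p, Subtype.ext hp, fun b => by rw [← coe_eq_zero, ← coe_eq_zero]; exact hap b⟩
      sup := fun s hs hb => by
        obtain ⟨a, -, ha⟩ := hA.cv s hs hb fun m n => hc _ _
        exact ⟨a, ha⟩ }
  have hP : ∀ p : A, p ∈ projections A ↔ p * p = p := fun p =>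
    ⟨fun h => Subtype.ext h, fun h => congrArg Subtype.val h⟩
  let G : A →ₗ[ℝ] continuousFunctions X :=
    { toFun := fun a => ⟨gelfand hP e hS a, (gelfand hP e hS a).continuous⟩
      map_add' := fun a b => Subtype.ext (by rw [map_add]; rfl)
      map_smul' := fun r a => Subtype.ext (by rw [map_smul]; rfl) }
  have hinj : Function.Injective G := fun a b h => gelfand_injective hP e hS
    (ContinuousMap.ext fun x => congrFun (congrArg Subtype.val h) x)
  have hsurj : Function.Surjective G := fun f => by
    obtain ⟨a, ha⟩ := gelfand_surjective hP e hS ⟨f, f.2⟩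
    exact ⟨a, Subtype.ext (funext fun x => DFunLike.congr_fun ha x)⟩
  obtain ⟨Ψ, hΨ⟩ : ∃ Ψ : A ≃ₗ[ℝ] continuousFunctions X,
      ∀ a x, (Ψ a : X → ℝ) x = gelfand hP e hS a x :=
    ⟨LinearEquiv.ofBijective G (And.intro hinj hsurj), fun _ _ => rfl⟩
  have hΨmul : ∀ a b : A, (Ψ (a * b) : X → ℝ) = Ψ a * Ψ b := fun a b => by
    ext x
    rw [Pi.mul_apply, hΨ, hΨ, hΨ, map_mul]
    rfl
  refine ⟨Ψ, ?_, ?_, ?_, ?_⟩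
  · intro a ha
    have : a = 1 := Subtype.ext ha
    ext x
    rw [hΨ, this, map_one]
    rfl
  · intro a b c
    rw [← hΨmul, ← coe_mul]
    exact ⟨fun h => by rw [Subtype.ext h], fun h => by rw [Ψ.injective (Subtype.ext h)]⟩
  · intro a b
    rw [← gelfand_le_iff hP e hS]
    constructor
    · intro h x
      have := h x
      rwa [hΨ, hΨ] at this
    · intro h x
      rw [hΨ, hΨ]
      exact h x
  · intro p
    ext x
    rw [hΨ, gelfand_apply]
    by_cases h : x ∈ e p
    · rw [value_idem_of_mem hP e hS h]
      exact (Set.indicator_of_mem (s := (e p : Set X)) h fun _ => (1 : ℝ)).symm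
    · rw [value_idem_of_notMem hP e hS h]
      exact (Set.indicator_of_notMem (s := (e p : Set X)) h fun _ => (1 : ℝ)).symm

/-- The Stone space of the projections is nonempty. -/
theorem IsGHAlgebra.nonempty_stone (hA : IsGHAlgebra A)
    {X : Type*} [TopologicalSpace X] (e : projections A ≃o TopologicalSpace.Clopens X) :
    Nonempty X := by
  by_contra h
  rw [not_nonempty_iff] at h
  let p : projections A := ⟨0, mul_zero 0⟩
  let q : projections A := ⟨⟨1, hA.one_mem⟩, mul_one 1⟩
  have h1 : p = q := e.injective (by ext x; exact h.elim x)
  have h2 : (0 : R) = 1 := congrArg (fun t : projections A => ((t : A) : R)) h1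
  exact hA.one_ne_zero h2.symm

end Commutative

/-! ### Composition and transport of morphisms. -/

section Morphisms

variable {R₁ R₂ R₃ : Type*} [Ring R₁] [Algebra ℝ R₁] [Ring R₂] [Algebra ℝ R₂]
  [Ring R₃] [Algebra ℝ R₃] {A₁ : Submodule ℝ R₁} [PartialOrder A₁]
  {A₂ : Submodule ℝ R₂} [PartialOrder A₂] {A₃ : Submodule ℝ R₃} [PartialOrder A₃]

theorem IsGHMorphism.comp {φ : A₂ →ₗ[ℝ] A₃} {ψ : A₁ →ₗ[ℝ] A₂} (hφ : IsGHMorphism A₂ A₃ φ)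
    (hψ : IsGHMorphism A₁ A₂ ψ) : IsGHMorphism A₁ A₃ (φ ∘ₗ ψ) where
  source := hψ.source
  target := hφ.target
  map_one a ha := hφ.map_one _ (hψ.map_one a ha)
  map_sq a c h := hφ.map_sq _ _ (hψ.map_sq a c h)
  map_commute a b h := hφ.map_commute _ _ (hψ.map_commute a b h)
  map_carrier a p h := hφ.map_carrier _ _ (hψ.map_carrier a p h)
  map_sup s a hs hcomm ha := by
    obtain ⟨h1, h2⟩ := hψ.map_sup s a hs hcomm ha
    exact hφ.map_sup _ _ h1 (fun m n => hψ.map_commute _ _ (hcomm m n)) h2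

/-- A unital multiplicative order isomorphism of commutative GH-algebras is a morphism. -/
theorem isGHMorphism_of_linearEquiv (h₁ : IsGHAlgebra A₁) (h₂ : IsGHAlgebra A₂)
    (hc : IsCommutative A₂) (φ : A₁ ≃ₗ[ℝ] A₂) (hone : ∀ a : A₁, (a : R₁) = 1 → (φ a : R₂) = 1)
    (hmul : ∀ a b c : A₁, (c : R₁) = a * b ↔ (φ c : R₂) = φ a * φ b)
    (hle : ∀ a b : A₁, φ a ≤ φ b ↔ a ≤ b) : IsGHMorphism A₁ A₂ φ.toLinearMap where
  source := h₁
  target := h₂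
  map_one := hone
  map_sq a c h := (hmul a a c).1 h
  map_commute a b _ := hc _ _
  map_carrier a p h := by
    -- Carriers depend only on which products vanish, and that is the case `c = 0` of `hmul`.
    have h0 : ∀ a b : A₁, (φ a : R₂) * φ b = 0 ↔ (a : R₁) * b = 0 := fun a b => by
      have := hmul a b 0
      rw [map_zero, Submodule.coe_zero, Submodule.coe_zero] at this
      rw [eq_comm, ← this, eq_comm]
    refine ⟨((hmul p p p).1 h.1.symm).symm, fun b => ?_⟩
    obtain ⟨b, rfl⟩ := φ.surjective b
    exact (h0 a b).trans ((h.2 b).trans (h0 p b).symm)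
  map_sup s a hs _ ha := by
    refine ⟨fun m n hmn => (hle _ _).2 (hs hmn), ?_, ?_⟩
    · rintro _ ⟨n, rfl⟩
      exact (hle _ _).2 (ha.1 ⟨n, rfl⟩)
    · intro b hb
      obtain ⟨b, rfl⟩ := φ.surjective b
      refine (hle _ _).2 (ha.2 ?_)
      rintro _ ⟨n, rfl⟩
      exact (hle _ _).1 (hb ⟨n, rfl⟩)

end Morphisms

/-! ### The continuous representative of a bounded Baire function. -/

section Continuous

variable {X : Type*} [TopologicalSpace X]

theorem isGHAlgebra_continuousFunctions [CompactSpace X] [Nonempty X]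
    (hcar : ∀ a : continuousFunctions X, ∃ p, IsCarrier (continuousFunctions X) a p)
    (hsup : ∀ s : ℕ → continuousFunctions X, Monotone s → BddAbove (Set.range s) →
      ∃ a, IsLUB (Set.range s) a) : IsGHAlgebra (continuousFunctions X) :=
  isGHAlgebra_of_functions _ (fun _ hf => isBoundedFun_of_continuous hf) continuous_const
    (fun _ hf _ hg => Continuous.mul hf hg) (fun _ hf => Continuous.sqrt hf)
    (fun _ hf h => Continuous.inv₀ hf fun x => (zero_lt_one.trans_le (h x)).ne') hcar hsup

variable [CompactSpace X] [T2Space X] (hX : IsBasicallyDisconnected X)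

/-- The continuous function that agrees with a given bounded Baire function up to a meagre set. -/
noncomputable def continuousPart : baireFunctions X →ₗ[ℝ] continuousFunctions X :=
  have spec (f : baireFunctions X) :=
    (exists_continuous_residualEq hX f.2.2 f.2.1).choose_spec
  { toFun := fun f => ⟨(exists_continuous_residualEq hX f.2.2 f.2.1).choose,
      ContinuousMap.continuous _⟩
    -- Linearity comes from uniqueness: continuous functions that agree off a meagre set are equal.
    map_add' := fun f g => Subtype.ext <| eq_of_residual_eq (ContinuousMap.continuous _)
      ((ContinuousMap.continuous _).add (ContinuousMap.continuous _))
      ((spec (f + g)).symm.trans ((spec f).add (spec g)))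
    map_smul' := fun r f => Subtype.ext <| eq_of_residual_eq (ContinuousMap.continuous _)
      ((ContinuousMap.continuous _).const_smul r)
      ((spec (r • f)).symm.trans ((spec f).const_smul r)) }

theorem continuousPart_residualEq (f : baireFunctions X) :
    (f : X → ℝ) =ᶠ[residual X] continuousPart hX f :=
  (exists_continuous_residualEq hX f.2.2 f.2.1).choose_spec

theorem continuousPart_eq_iff (f : baireFunctions X) (g : continuousFunctions X) :
    continuousPart hX f = g ↔ (f : X → ℝ) =ᶠ[residual X] g := by
  refine ⟨fun h => h ▸ continuousPart_residualEq hX f, fun h => ?_⟩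
  exact Subtype.ext (eq_of_residual_eq (Subtype.prop _) g.2
    ((continuousPart_residualEq hX f).symm.trans h))

theorem continuousPart_mono {f g : baireFunctions X} (h : f ≤ g) :
    continuousPart hX f ≤ continuousPart hX g := by
  refine le_of_residual_le (Subtype.prop _) (Subtype.prop _) ?_
  filter_upwards [continuousPart_residualEq hX f, continuousPart_residualEq hX g] with x h1 h2
  rw [← h1, ← h2]
  exact h x

theorem continuousPart_surjective : Function.Surjective (continuousPart hX) := fun g =>
  ⟨⟨g, continuousFunctions_le_baireFunctions g.2⟩,
    (continuousPart_eq_iff hX _ _).2 EventuallyEq.rfl⟩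

/-- Each property holds pointwise off a meagre set, and relations between continuous functions
extend from there to all of `X`. -/
theorem isGHMorphism_continuousPart [Nonempty X] (hC : IsGHAlgebra (continuousFunctions X)) :
    IsGHMorphism (baireFunctions X) (continuousFunctions X) (continuousPart hX) where
  source := isGHAlgebra_baireFunctions
  target := hC
  map_one f hf := eq_of_residual_eq (Subtype.prop _) continuous_const
    ((continuousPart_residualEq hX f).symm.trans (EventuallyEq.of_eq hf))
  map_sq f g h := by
    refine eq_of_residual_eq (Subtype.prop _) (Continuous.mul (Subtype.prop _) (Subtype.prop _)) ?_
    refine (continuousPart_residualEq hX g).symm.trans ?_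
    rw [h]
    exact (continuousPart_residualEq hX f).mul (continuousPart_residualEq hX f)
  map_commute _ _ _ := Commute.all _ _
  map_carrier f p h := by
    have hf := continuousPart_residualEq hX f
    have hp := continuousPart_residualEq hX p
    constructor
    · refine eq_of_residual_eq (Continuous.mul (Subtype.prop _) (Subtype.prop _))
        (Subtype.prop _) ((hp.mul hp).symm.trans ?_)
      have h1 : (p : X → ℝ) * p = p := h.1
      exact (EventuallyEq.of_eq h1).trans hp
    · intro b
      have key : ∀ g : baireFunctions X, (continuousPart hX g : X → ℝ) * (b : X → ℝ) = 0 ↔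
          (g : X → ℝ) * (b : X → ℝ) =ᶠ[residual X] 0 := by
        intro g
        have hg := (continuousPart_residualEq hX g).mul (EventuallyEq.refl _ (b : X → ℝ))
        refine ⟨fun h0 => hg.trans (EventuallyEq.of_eq h0), fun h0 => ?_⟩
        exact eq_of_residual_eq (Continuous.mul (Subtype.prop _) b.2) continuous_const
          (hg.symm.trans h0)
      rw [key, key]
      refine eventually_congr (Eventually.of_forall fun x => ?_)
      simp only [Pi.mul_apply, Pi.zero_apply, mul_eq_zero, eq_zero_iff_of_isCarrier h x]
  map_sup s f hs _ hf := by
    refine ⟨fun m n hmn => continuousPart_mono hX (hs hmn), ?_, ?_⟩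
    · rintro _ ⟨n, rfl⟩
      exact continuousPart_mono hX (hf.1 ⟨n, rfl⟩)
    · intro u hu
      obtain ⟨hmem, hlub⟩ := isLUB_iSup_baireFunctions ⟨f, hf.1⟩
      have hfs := hf.unique hlub
      refine le_of_residual_le (Subtype.prop _) u.2 ?_
      -- Off one meagre set, `f` and all the `s n` equal their continuous parts simultaneously, and
      -- there `f` is the pointwise supremum, so it lies below `u`.
      filter_upwards [continuousPart_residualEq hX f,
        eventually_countable_forall.2 fun n => continuousPart_residualEq hX (s n)] with x h1 h2
      rw [← h1, hfs]
      refine ciSup_le fun n => ?_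
      rw [h2]
      exact hu ⟨n, rfl⟩ x

end Continuous

end GHAlg

/-! ### Assembly of the Loomis–Sikorski theorem. -/

theorem theorem6p5 {R : Type*} [Ring R] [Algebra ℝ R] (A : Submodule ℝ R) [PartialOrder A]
    (hA : GHAlg.IsGHAlgebra A) (hcomm : GHAlg.IsCommutative A)
    {X : Type*} [TopologicalSpace X] [CompactSpace X] [T2Space X] [TotallyDisconnectedSpace X]
    (e : GHAlg.projections A ≃o TopologicalSpace.Clopens X) :
    GHAlg.IsBasicallyDisconnected X ∧
    ∃ T : Submodule ℝ (X → ℝ),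
      GHAlg.IsGHTribe (T : Set (X → ℝ)) ∧
      GHAlg.IsGHAlgebra T ∧
      GHAlg.continuousFunctions X ≤ T ∧
      (∀ f : X → ℝ, f ∈ T ↔ GHAlg.IsBoundedFun f ∧ GHAlg.IsBaireFun f) ∧
      ∃ h : T →ₗ[ℝ] A,
        GHAlg.IsGHMorphism T A h ∧
        Function.Surjective h ∧
        ∃ Ψ : A ≃ₗ[ℝ] GHAlg.continuousFunctions X,
          GHAlg.IsGHMorphism A (GHAlg.continuousFunctions X) Ψ.toLinearMap ∧
          GHAlg.IsGHMorphism (GHAlg.continuousFunctions X) A Ψ.symm.toLinearMap ∧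
          (∀ p : GHAlg.projections A,
            (Ψ (p : A) : X → ℝ) = Set.indicator (e p : Set X) (fun _ => 1)) ∧
          ∀ (f : T) (a : A),
            h f = a ↔ IsMeagre {x : X | (f : X → ℝ) x ≠ (Ψ a : X → ℝ) x} := by
  have hne : Nonempty X := hA.nonempty_stone e
  obtain ⟨Ψ, hone, hmul, hle, hproj⟩ := hA.exists_representation hcomm e
  -- Axiom CV of `A`, carried to `C(X, ℝ)` along the order isomorphism `Ψ`.
  have hsup : ∀ s : ℕ → GHAlg.continuousFunctions X, Monotone s → BddAbove (Set.range s) →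
      ∃ a, IsLUB (Set.range s) a := by
    intro s hs ⟨b, hb⟩
    have hle' : ∀ f g, Ψ.symm f ≤ Ψ.symm g ↔ f ≤ g := fun f g => by
      rw [← hle, Ψ.apply_symm_apply, Ψ.apply_symm_apply]
    obtain ⟨a, -, ha⟩ := hA.cv (fun n => Ψ.symm (s n)) (fun m n h => (hle' _ _).2 (hs h))
      ⟨Ψ.symm b, by rintro _ ⟨n, rfl⟩; exact (hle' _ _).2 (hb ⟨n, rfl⟩)⟩ fun _ _ => hcomm _ _
    refine ⟨Ψ a, ?_, fun c hc => ?_⟩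
    · rintro _ ⟨n, rfl⟩
      rw [← hle', Ψ.symm_apply_apply]
      exact ha.1 ⟨n, rfl⟩
    · rw [← hle', Ψ.symm_apply_apply]
      refine ha.2 ?_
      rintro _ ⟨n, rfl⟩
      exact (hle' _ _).2 (hc ⟨n, rfl⟩)
  have hX : GHAlg.IsBasicallyDisconnected X :=
    GHAlg.isBasicallyDisconnected_of_sup fun s hs ⟨b, hb⟩ => by
      obtain ⟨a, ha⟩ := hsup (fun n => ⟨s n, (s n).continuous⟩) (fun m n h => hs h)
        ⟨⟨b, b.continuous⟩, by rintro _ ⟨n, rfl⟩; exact hb ⟨n, rfl⟩⟩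
      refine ⟨⟨a, a.2⟩, ?_, fun c hc => ?_⟩
      · rintro _ ⟨n, rfl⟩
        exact ha.1 ⟨n, rfl⟩
      · exact ha.2 (show (⟨c, c.continuous⟩ : GHAlg.continuousFunctions X) ∈ _ by
          rintro _ ⟨n, rfl⟩
          exact hc ⟨n, rfl⟩)
  have h0 : ∀ a b : A, (Ψ a : X → ℝ) * Ψ b = 0 ↔ (a : R) * b = 0 := fun a b => by
    have := hmul a b 0
    rw [map_zero, Submodule.coe_zero, Submodule.coe_zero] at this
    rw [eq_comm, ← this, eq_comm]
  -- For `C(X, ℝ)` the only axioms that are not pointwise are carriers and suprema; both are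
  -- inherited from `A` through `Ψ`.
  have hC : GHAlg.IsGHAlgebra (GHAlg.continuousFunctions X) := by
    refine GHAlg.isGHAlgebra_continuousFunctions (fun f => ?_) hsup
    obtain ⟨a, rfl⟩ := Ψ.surjective f
    obtain ⟨p, hp, hap⟩ := hA.sa6 a
    refine ⟨Ψ p, ((hmul p p p).1 hp.symm).symm, fun b => ?_⟩
    obtain ⟨b, rfl⟩ := Ψ.surjective b
    rw [h0, h0]
    exact hap b
  have hΨ : GHAlg.IsGHMorphism A (GHAlg.continuousFunctions X) Ψ.toLinearMap :=
    GHAlg.isGHMorphism_of_linearEquiv hA hC (fun _ _ => Commute.all _ _) Ψ hone hmul hle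
  have hΨ' : GHAlg.IsGHMorphism (GHAlg.continuousFunctions X) A Ψ.symm.toLinearMap := by
    refine GHAlg.isGHMorphism_of_linearEquiv hC hA hcomm Ψ.symm (fun f hf => ?_) (fun f g k => ?_)
      (fun f g => ?_)
    · have h1 := hone ⟨1, hA.one_mem⟩ rfl
      have h2 : f = Ψ ⟨1, hA.one_mem⟩ := Subtype.ext (hf.trans h1.symm)
      rw [h2, Ψ.symm_apply_apply]
    · rw [hmul]
      simp only [Ψ.apply_symm_apply]
    · rw [← hle, Ψ.apply_symm_apply, Ψ.apply_symm_apply]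
  refine ⟨hX, GHAlg.baireFunctions X, GHAlg.isGHTribe_baireFunctions,
    GHAlg.isGHAlgebra_baireFunctions, GHAlg.continuousFunctions_le_baireFunctions,
    fun _ => Iff.rfl, Ψ.symm.toLinearMap ∘ₗ GHAlg.continuousPart hX,
    hΨ'.comp (GHAlg.isGHMorphism_continuousPart hX hC),
    Ψ.symm.surjective.comp (GHAlg.continuousPart_surjective hX), Ψ, hΨ, hΨ', hproj, ?_⟩
  intro f a
  rw [GHAlg.isMeagre_ne_iff, ← GHAlg.continuousPart_eq_iff hX, ← Ψ.symm_apply_eq]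
  rfl
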